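/- Let $G$ be a group acting on a countably infinite set $S$, and fix $s_0\in S$. Let $\mathrm{Mat}_S(\mathbb Z)$ be the ring of integer matrices with rows and columns indexed by $S$ that have only finitely many non-zero entries in each row and in each column, let $\mathrm{Mat}^0_S(\mathbb Z)$ be its two-sided ideal of matrices with only finitely many non-zero entries, and let $E_{s,t}$ be the matrix with $1$ in row $s$ and column $t$ and zeroes elsewhere. Let $\phi_0:\mathbb Z[G]\to\mathrm{Mat}_S(\mathbb Z)$ be the ring homomorphism that sends $g\in G$ to the permutation matrix $\sum_{s\in S}E_{gs,s}$. Let $R_{G,S}$ be the ring with additive group $\mathbb Z[G]\oplus\mathrm{Mat}^0_S(\mathbb Z)$ and multiplication $$(f,m)(f',m')=(ff',\ \phi_0(f)m'+m\phi_0(f')+mm'),$$ in which $\mathrm{Mat}^0_S(\mathbb Z)$ is a two-sided ideal. For a unital associative ring $R$, let $\mathrm{St}_4(R)$ be the Steinberg group: it is generated by the symbols $e_{ij}(r)$ with $1\le i\ne j\le 4$ and $r\in R$, subject to the relations $e_{ij}(r)e_{ij}(r')=e_{ij}(r+r')$; $[e_{ij}(r),e_{jk}(r')]=e_{ik}(rr')$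 for $i,j,k$ distinct; and $[e_{ij}(r),e_{pq}(r')]=1$ for $j\ne p$ and $i\ne q$, where $[a,b]=aba^{-1}b^{-1}$. Put $E=E_{s_0,s_0}\in R_{G,S}$ and $\tilde r(E)=\bigl(e_{12}(-E)\,e_{21}(E)\,e_{12}(-E)\bigr)^4$. Let $\Gamma_0$ be the quotient of $\mathrm{St}_4(R_{G,S})$ by the normal subgroup generated by $\tilde r(E)$, and let $\Delta_0$ be the subgroup of $\Gamma_0$ generated by the images of all $e_{ij}(x)$ with $i\neq j$ and $x\in\mathrm{Mat}^0_S(\mathbb Z)$. Then $\Delta_0$ is isomorphic to $\mathrm{SL}_\infty(\mathbb Z)$, the group of invertible integer matrices indexed by $\mathbb N$ that differ from the identity matrix at only finitely many places and have determinant $1$. -/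

import Mathlib

/-- Integer matrices with rows and columns indexed by `S` such that every row and every column
has only finitely many non-zero entries. -/
@[ext]
structure RCFMatrix (S : Type*) where
  entry : S → S → ℤ
  row_finite : ∀ i, {j | entry i j ≠ 0}.Finite
  col_finite : ∀ j, {i | entry i j ≠ 0}.Finite

namespace RCFMatrix

variable {S : Type*}

instance : Zero (RCFMatrix S) := ⟨⟨fun _ _ => 0, by simp, by simp⟩⟩

open Classical in
/-- The permutation matrix `∑ s, E_{σ s, s}`. -/
noncomputable def perm (σ : Equiv.Perm S) : RCFMatrix S where
  entry i j := if i = σ j then 1 else 0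
  row_finite i := (Set.finite_singleton (σ.symm i)).subset fun j hj => by
    by_contra h
    exact hj (if_neg fun e => h (by simp [e]))
  col_finite j := (Set.finite_singleton (σ j)).subset fun i hi => by
    by_contra h
    exact hi (if_neg h)

/-- The identity matrix. -/
noncomputable instance : One (RCFMatrix S) := ⟨perm 1⟩

open Classical in
/-- The elementary matrix `E_{s,t}`, with `1` in row `s` and column `t` and zeroes elsewhere. -/
noncomputable def single (s t : S) : RCFMatrix S where
  entry i j := if i = s ∧ j = t then 1 else 0
  row_finite i := (Set.finite_singleton t).subset fun j hj => by
    by_contra h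
    exact hj (if_neg fun e => h e.2)
  col_finite j := (Set.finite_singleton s).subset fun i hi => by
    by_contra h
    exact hi (if_neg fun e => h e.1)

instance : Add (RCFMatrix S) := ⟨fun a b =>
  { entry := fun i j => a.entry i j + b.entry i j
    row_finite := fun i => ((a.row_finite i).union (b.row_finite i)).subset fun j hj => by
      by_contra h
      simp only [Set.mem_union, Set.mem_ofPred_eq, not_or, not_not] at h hj
      exact hj (by rw [h.1, h.2, add_zero])
    col_finite := fun j => ((a.col_finite j).union (b.col_finite j)).subset fun i hi => by
      by_contra h
      simp only [Set.mem_union, Set.mem_ofPred_eq, not_or, not_not] at h hi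
      exact hi (by rw [h.1, h.2, add_zero]) }⟩

instance : Neg (RCFMatrix S) := ⟨fun a =>
  { entry := fun i j => -a.entry i j
    row_finite := fun i => by simpa using a.row_finite i
    col_finite := fun j => by simpa using a.col_finite j }⟩

theorem exists_of_finsum_ne_zero {f : S → ℤ} (h : ∑ᶠ k, f k ≠ 0) : ∃ k, f k ≠ 0 := by
  by_contra! h'
  exact h (by simp [h'])

/-- Matrix multiplication; each sum `∑ₖ aᵢₖ bₖⱼ` has only finitely many non-zero terms. -/
noncomputable instance : Mul (RCFMatrix S) := ⟨fun a b =>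
  { entry := fun i j => ∑ᶠ k, a.entry i k * b.entry k j
    row_finite := fun i =>
      ((a.row_finite i).biUnion fun k _ => b.row_finite k).subset fun j hj => by
        obtain ⟨k, hk⟩ := exists_of_finsum_ne_zero hj
        exact Set.mem_biUnion (x := k) (left_ne_zero_of_mul hk) (right_ne_zero_of_mul hk)
    col_finite := fun j =>
      ((b.col_finite j).biUnion fun k _ => a.col_finite k).subset fun i hi => by
        obtain ⟨k, hk⟩ := exists_of_finsum_ne_zero hi
        exact Set.mem_biUnion (x := k) (right_ne_zero_of_mul hk) (left_ne_zero_of_mul hk) }⟩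

theorem zero_entry (i j : S) : (0 : RCFMatrix S).entry i j = 0 := rfl

theorem add_entry (a b : RCFMatrix S) (i j : S) :
    (a + b).entry i j = a.entry i j + b.entry i j := rfl

theorem neg_entry (a : RCFMatrix S) (i j : S) : (-a).entry i j = -a.entry i j := rfl

theorem mul_entry (a b : RCFMatrix S) (i j : S) :
    (a * b).entry i j = ∑ᶠ k, a.entry i k * b.entry k j := rfl

open Classical in
theorem perm_entry (σ : Equiv.Perm S) (i j : S) :
    (perm σ).entry i j = if i = σ j then 1 else 0 := rfl

theorem mul_entry_of_row (a b : RCFMatrix S) (i j : S) (T : Finset S)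
    (hT : ∀ k, a.entry i k ≠ 0 → k ∈ T) :
    (a * b).entry i j = ∑ k ∈ T, a.entry i k * b.entry k j :=
  finsum_eq_sum_of_support_subset _ fun k hk => hT k (left_ne_zero_of_mul hk)

theorem mul_entry_of_col (a b : RCFMatrix S) (i j : S) (T : Finset S)
    (hT : ∀ k, b.entry k j ≠ 0 → k ∈ T) :
    (a * b).entry i j = ∑ k ∈ T, a.entry i k * b.entry k j :=
  finsum_eq_sum_of_support_subset _ fun k hk => hT k (right_ne_zero_of_mul hk)

theorem perm_mul_entry (σ : Equiv.Perm S) (a : RCFMatrix S) (i j : S) :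
    (perm σ * a).entry i j = a.entry (σ.symm i) j := by
  classical
  rw [mul_entry_of_row _ _ _ _ {σ.symm i}]
  · simp [perm_entry]
  · intro k hk
    by_contra h
    refine hk (if_neg fun e => h ?_)
    simp [e]

theorem mul_perm_entry (σ : Equiv.Perm S) (a : RCFMatrix S) (i j : S) :
    (a * perm σ).entry i j = a.entry i (σ j) := by
  classical
  rw [mul_entry_of_col _ _ _ _ {σ j}]
  · simp [perm_entry]
  · intro k hk
    by_contra h
    exact hk (if_neg fun e => h (by simp [e]))

noncomputable instance : Ring (RCFMatrix S) where
  add_assoc a b c := by ext i j; simp only [add_entry, add_assoc]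
  zero_add a := by ext i j; simp only [add_entry, zero_entry, zero_add]
  add_zero a := by ext i j; simp only [add_entry, zero_entry, add_zero]
  add_comm a b := by ext i j; simp only [add_entry, add_comm]
  neg_add_cancel a := by ext i j; simp only [add_entry, neg_entry, zero_entry, neg_add_cancel]
  nsmul := nsmulRec
  zsmul := zsmulRec
  zero_mul a := by ext i j; simp [mul_entry, zero_entry]
  mul_zero a := by ext i j; simp [mul_entry, zero_entry]
  one_mul a := by ext i j; exact perm_mul_entry 1 a i j
  mul_one a := by ext i j; exact mul_perm_entry 1 a i j
  left_distrib a b c := by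
    ext i j
    have h : ∀ k, a.entry i k ≠ 0 → k ∈ (a.row_finite i).toFinset := fun k hk => by simpa using hk
    simp only [add_entry, mul_entry_of_row a _ i j _ h, mul_add, Finset.sum_add_distrib]
  right_distrib a b c := by
    ext i j
    have h : ∀ k, c.entry k j ≠ 0 → k ∈ (c.col_finite j).toFinset := fun k hk => by simpa using hk
    simp only [add_entry, mul_entry_of_col _ c i j _ h, add_mul, Finset.sum_add_distrib]
  mul_assoc a b c := by
    ext i j
    have ha : ∀ k, a.entry i k ≠ 0 → k ∈ (a.row_finite i).toFinset := fun k hk => by simpa using hk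
    have hc : ∀ k, c.entry k j ≠ 0 → k ∈ (c.col_finite j).toFinset := fun k hk => by simpa using hk
    rw [mul_entry_of_col _ c i j _ hc, mul_entry_of_row a _ i j _ ha]
    simp only [mul_entry_of_row a b i _ _ ha, mul_entry_of_col b c _ j _ hc,
      Finset.sum_mul, Finset.mul_sum]
    rw [Finset.sum_comm]
    simp only [mul_assoc]

theorem perm_mul (σ τ : Equiv.Perm S) : perm (σ * τ) = perm σ * perm τ := by
  ext i j
  rw [perm_mul_entry, perm_entry, perm_entry]
  by_cases h : i = (σ * τ) j
  · rw [if_pos h, if_pos (by rw [h]; simp)]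
  · rw [if_neg h, if_neg fun e => h (by rw [Equiv.Perm.mul_apply, ← e]; simp)]

/-- The two-sided ideal of matrices with only finitely many non-zero entries. -/
noncomputable def finMat (S : Type*) : TwoSidedIdeal (RCFMatrix S) :=
  TwoSidedIdeal.mk' {a | {p : S × S | a.entry p.1 p.2 ≠ 0}.Finite}
    (by simp [zero_entry])
    (fun {a b} ha hb => (ha.union hb).subset fun p hp => by
      by_contra h
      simp only [Set.mem_union, Set.mem_ofPred_eq, not_or, not_not] at h hp
      exact hp (by rw [add_entry, h.1, h.2, add_zero]))
    (fun {a} ha => by simpa [neg_entry] using ha)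
    (fun {a b} hb =>
      (hb.biUnion (t := fun p => (fun i => (i, p.2)) '' {i | a.entry i p.1 ≠ 0})
        fun p _ => (a.col_finite p.1).image _).subset fun p hp => by
          obtain ⟨k, hk⟩ := exists_of_finsum_ne_zero hp
          exact Set.mem_biUnion (x := (k, p.2)) (right_ne_zero_of_mul hk)
            ⟨p.1, left_ne_zero_of_mul hk, rfl⟩)
    (fun {a b} ha =>
      (ha.biUnion (t := fun p => (fun j => (p.1, j)) '' {j | b.entry p.2 j ≠ 0})
        fun p _ => (b.row_finite p.2).image _).subset fun p hp => by
          obtain ⟨k, hk⟩ := exists_of_finsum_ne_zero hp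
          exact Set.mem_biUnion (x := (p.1, k)) (left_ne_zero_of_mul hk)
            ⟨p.2, right_ne_zero_of_mul hk, rfl⟩)

theorem mem_finMat (a : RCFMatrix S) :
    a ∈ finMat S ↔ {p : S × S | a.entry p.1 p.2 ≠ 0}.Finite := by
  simp [finMat]

theorem single_mem_finMat (s t : S) : single s t ∈ finMat S := by
  rw [mem_finMat]
  refine (Set.finite_singleton (s, t)).subset fun p hp => ?_
  by_contra h
  exact hp (if_neg fun e => h (Prod.ext e.1 e.2))

/-- The ring homomorphism `ℤ[G] → Mat_S(ℤ)` attached to an action of `G` on `S`; it sends `g` to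
the permutation matrix `∑ s, E_{g s, s}`. -/
noncomputable def phi₀ (G S : Type*) [Group G] [MulAction G S] :
    MonoidAlgebra ℤ G →+* RCFMatrix S :=
  (MonoidAlgebra.lift ℤ (RCFMatrix S) G
    { toFun := fun g => perm (MulAction.toPermHom G S g)
      map_one' := by rw [map_one]; rfl
      map_mul' := fun g h => by rw [map_mul, perm_mul] }).toRingHom

end RCFMatrix

/-- The semidirect product of `ℤ[G]` and the ideal of finitely supported `S × S` matrices: the
abelian group `ℤ[G] ⊕ Mat⁰_S(ℤ)` with the product
`(f, m) (f', m') = (f f', φ₀(f) m' + m φ₀(f') + m m')`. -/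
@[ext]
structure CrazyRing (G S : Type*) [Group G] [MulAction G S] where
  fst : MonoidAlgebra ℤ G
  snd : RCFMatrix S
  snd_mem : snd ∈ RCFMatrix.finMat S

namespace CrazyRing

open RCFMatrix

variable {G S : Type*} [Group G] [MulAction G S]

noncomputable instance : Zero (CrazyRing G S) := ⟨⟨0, 0, (finMat S).zero_mem⟩⟩

noncomputable instance : One (CrazyRing G S) := ⟨⟨1, 0, (finMat S).zero_mem⟩⟩

noncomputable instance : Add (CrazyRing G S) :=
  ⟨fun x y => ⟨x.fst + y.fst, x.snd + y.snd, (finMat S).add_mem x.snd_mem y.snd_mem⟩⟩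

noncomputable instance : Neg (CrazyRing G S) :=
  ⟨fun x => ⟨-x.fst, -x.snd, (finMat S).neg_mem x.snd_mem⟩⟩

noncomputable instance : Mul (CrazyRing G S) :=
  ⟨fun x y =>
    ⟨x.fst * y.fst, phi₀ G S x.fst * y.snd + x.snd * phi₀ G S y.fst + x.snd * y.snd,
      (finMat S).add_mem
        ((finMat S).add_mem ((finMat S).mul_mem_left _ _ y.snd_mem)
          ((finMat S).mul_mem_right _ _ x.snd_mem))
        ((finMat S).mul_mem_left _ _ y.snd_mem)⟩⟩

noncomputable instance : Ring (CrazyRing G S) where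
  add_assoc x y z := CrazyRing.ext (add_assoc _ _ _) (add_assoc _ _ _)
  zero_add x := CrazyRing.ext (zero_add _) (zero_add _)
  add_zero x := CrazyRing.ext (add_zero _) (add_zero _)
  add_comm x y := CrazyRing.ext (add_comm _ _) (add_comm _ _)
  neg_add_cancel x := CrazyRing.ext (neg_add_cancel _) (neg_add_cancel _)
  nsmul := nsmulRec
  zsmul := zsmulRec
  zero_mul x := CrazyRing.ext (zero_mul _) (by
    change phi₀ G S 0 * x.snd + 0 * phi₀ G S x.fst + 0 * x.snd = 0
    simp)
  mul_zero x := CrazyRing.ext (mul_zero _) (by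
    change phi₀ G S x.fst * 0 + x.snd * phi₀ G S 0 + x.snd * 0 = 0
    simp)
  one_mul x := CrazyRing.ext (one_mul _) (by
    change phi₀ G S 1 * x.snd + 0 * phi₀ G S x.fst + 0 * x.snd = x.snd
    simp)
  mul_one x := CrazyRing.ext (mul_one _) (by
    change phi₀ G S x.fst * 0 + x.snd * phi₀ G S 1 + x.snd * 0 = x.snd
    simp)
  left_distrib x y z := CrazyRing.ext (mul_add _ _ _) (by
    change phi₀ G S x.fst * (y.snd + z.snd) + x.snd * phi₀ G S (y.fst + z.fst)
        + x.snd * (y.snd + z.snd)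
      = (phi₀ G S x.fst * y.snd + x.snd * phi₀ G S y.fst + x.snd * y.snd)
        + (phi₀ G S x.fst * z.snd + x.snd * phi₀ G S z.fst + x.snd * z.snd)
    rw [map_add]; noncomm_ring)
  right_distrib x y z := CrazyRing.ext (add_mul _ _ _) (by
    change phi₀ G S (x.fst + y.fst) * z.snd + (x.snd + y.snd) * phi₀ G S z.fst
        + (x.snd + y.snd) * z.snd
      = (phi₀ G S x.fst * z.snd + x.snd * phi₀ G S z.fst + x.snd * z.snd)
        + (phi₀ G S y.fst * z.snd + y.snd * phi₀ G S z.fst + y.snd * z.snd)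
    rw [map_add]; noncomm_ring)
  mul_assoc x y z := CrazyRing.ext (mul_assoc _ _ _) (by
    change phi₀ G S (x.fst * y.fst) * z.snd
        + (phi₀ G S x.fst * y.snd + x.snd * phi₀ G S y.fst + x.snd * y.snd) * phi₀ G S z.fst
        + (phi₀ G S x.fst * y.snd + x.snd * phi₀ G S y.fst + x.snd * y.snd) * z.snd
      = phi₀ G S x.fst * (phi₀ G S y.fst * z.snd + y.snd * phi₀ G S z.fst + y.snd * z.snd)
        + x.snd * phi₀ G S (y.fst * z.fst)
        + x.snd * (phi₀ G S y.fst * z.snd + y.snd * phi₀ G S z.fst + y.snd * z.snd)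
    rw [map_mul, map_mul]; noncomm_ring)

/-- The standard copy `{(0, m)}` of `Mat⁰_S(ℤ)` in the semidirect product. -/
noncomputable def matIdeal (G S : Type*) [Group G] [MulAction G S] :
    TwoSidedIdeal (CrazyRing G S) :=
  TwoSidedIdeal.mk' {x | x.fst = 0} rfl
    (fun {x y} hx hy => by
      change x.fst + y.fst = 0
      rw [show x.fst = 0 from hx, show y.fst = 0 from hy, add_zero])
    (fun {x} hx => by
      change -x.fst = 0
      rw [show x.fst = 0 from hx, neg_zero])
    (fun {x y} hy => by
      change x.fst * y.fst = 0
      rw [show y.fst = 0 from hy, mul_zero])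
    (fun {x y} hx => by
      change x.fst * y.fst = 0
      rw [show x.fst = 0 from hx, zero_mul])

/-- The elementary matrix `E_{s,s}` as an element of the semidirect product. -/
noncomputable def idem (G : Type*) {S : Type*} [Group G] [MulAction G S] (s : S) :
    CrazyRing G S :=
  ⟨0, single s s, single_mem_finMat s s⟩

end CrazyRing

/-- Generators `e_{ij}(r)`, `i ≠ j`, of the Steinberg group with index set `ι`. -/
structure SteinbergGen (ι R : Type*) where
  row : ι
  col : ι
  ne : row ≠ col
  coeff : R

open scoped commutatorElement in
/-- The Steinberg relators, with `⁅a, b⁆ = a b a⁻¹ b⁻¹`. -/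
inductive SteinbergRel (ι R : Type*) [Ring R] : FreeGroup (SteinbergGen ι R) → Prop
  | add (i j : ι) (hij : i ≠ j) (r s : R) : SteinbergRel ι R
      (FreeGroup.of ⟨i, j, hij, r⟩ * FreeGroup.of ⟨i, j, hij, s⟩
        * (FreeGroup.of ⟨i, j, hij, r + s⟩)⁻¹)
  | mul (i j k : ι) (hij : i ≠ j) (hjk : j ≠ k) (hik : i ≠ k) (r s : R) : SteinbergRel ι R
      (⁅FreeGroup.of (⟨i, j, hij, r⟩ : SteinbergGen ι R), FreeGroup.of ⟨j, k, hjk, s⟩⁆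
        * (FreeGroup.of ⟨i, k, hik, r * s⟩)⁻¹)
  | comm (i j p q : ι) (hij : i ≠ j) (hpq : p ≠ q) (hjp : j ≠ p) (hiq : i ≠ q) (r s : R) :
      SteinbergRel ι R
        ⁅FreeGroup.of (⟨i, j, hij, r⟩ : SteinbergGen ι R), FreeGroup.of ⟨p, q, hpq, s⟩⁆

/-- The Steinberg group over `R` with index set `ι`; `St_n(R)` is the case `ι = Fin n`. -/
abbrev Steinberg (ι R : Type*) [Ring R] : Type _ :=
  PresentedGroup {w : FreeGroup (SteinbergGen ι R) | SteinbergRel ι R w}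

namespace Steinberg

variable {ι R : Type*} [Ring R]

/-- The element `e_{ij}(r)` of the Steinberg group. -/
def e (i j : ι) (hij : i ≠ j) (r : R) : Steinberg ι R :=
  PresentedGroup.of ⟨i, j, hij, r⟩

/-- The element `(e₁₂(-E) e₂₁(E) e₁₂(-E))⁴` of `St₄(R)`; rows are numbered from `0`. -/
def rTilde (E : R) : Steinberg (Fin 4) R :=
  (e 0 1 (by decide) (-E) * e 1 0 (by decide) E * e 0 1 (by decide) (-E)) ^ 4

end Steinberg

/-- The quotient `Γ₀` of `St₄(R_{G,S})` by the relation `r̃(E_{s₀,s₀}) = 1`. -/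
abbrev Gamma₀ (G : Type*) {S : Type*} [Group G] [MulAction G S] (s₀ : S) : Type _ :=
  Steinberg (Fin 4) (CrazyRing G S) ⧸
    Subgroup.normalClosure {Steinberg.rTilde (CrazyRing.idem G s₀)}

/-- The subgroup `Δ₀` of `Γ₀` generated by all `e_{ij}(x)` with `x` in the ideal `Mat⁰_S(ℤ)`. -/
def Delta₀ (G : Type*) {S : Type*} [Group G] [MulAction G S] (s₀ : S) : Subgroup (Gamma₀ G s₀) :=
  Subgroup.closure {g | ∃ (i j : Fin 4) (hij : i ≠ j) (x : CrazyRing G S),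
    x ∈ CrazyRing.matIdeal G S ∧ g = QuotientGroup.mk (Steinberg.e i j hij x)}

/-- `GL_∞(ℤ)`: the invertible matrices indexed by `ℕ` that differ from the identity matrix at only
finitely many places. -/
def GLInf : Subgroup (RCFMatrix ℕ)ˣ where
  carrier := {g | (g : RCFMatrix ℕ) - 1 ∈ RCFMatrix.finMat ℕ}
  one_mem' := by
    change ((1 : (RCFMatrix ℕ)ˣ) : RCFMatrix ℕ) - 1 ∈ RCFMatrix.finMat ℕ
    rw [Units.val_one, sub_self]
    exact (RCFMatrix.finMat ℕ).zero_mem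
  mul_mem' {g h} hg hh := by
    change ((g * h : (RCFMatrix ℕ)ˣ) : RCFMatrix ℕ) - 1 ∈ RCFMatrix.finMat ℕ
    have e : ((g * h : (RCFMatrix ℕ)ˣ) : RCFMatrix ℕ) - 1
        = (g : RCFMatrix ℕ) * ((h : RCFMatrix ℕ) - 1) + ((g : RCFMatrix ℕ) - 1) := by
      rw [Units.val_mul]; noncomm_ring
    rw [e]
    exact (RCFMatrix.finMat ℕ).add_mem ((RCFMatrix.finMat ℕ).mul_mem_left _ _ hh) hg
  inv_mem' {g} hg := by
    change ((g⁻¹ : (RCFMatrix ℕ)ˣ) : RCFMatrix ℕ) - 1 ∈ RCFMatrix.finMat ℕ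
    have e : ((g⁻¹ : (RCFMatrix ℕ)ˣ) : RCFMatrix ℕ) - 1
        = -((g⁻¹ : (RCFMatrix ℕ)ˣ) * ((g : RCFMatrix ℕ) - 1)) := by
      rw [mul_sub, Units.inv_mul, mul_one, neg_sub]
    rw [e]
    exact (RCFMatrix.finMat ℕ).neg_mem ((RCFMatrix.finMat ℕ).mul_mem_left _ _ hg)

/-- The upper left `n × n` block of an infinite matrix. -/
def RCFMatrix.block (n : ℕ) (a : RCFMatrix ℕ) : Matrix (Fin n) (Fin n) ℤ :=
  Matrix.of fun i j => a.entry i j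

theorem RCFMatrix.block_one (n : ℕ) : RCFMatrix.block n 1 = 1 := by
  classical
  ext i j
  change (RCFMatrix.perm (1 : Equiv.Perm ℕ)).entry i j = _
  rw [RCFMatrix.perm_entry, Matrix.one_apply]
  by_cases h : i = j
  · rw [if_pos h, if_pos (by rw [h]; rfl)]
  · rw [if_neg h]
    exact if_neg fun e => h (Fin.ext e)

theorem GLInf.eventually_block_mul (g : GLInf) (b : RCFMatrix ℕ) :
    ∀ᶠ n in Filter.atTop, RCFMatrix.block n ((g : (RCFMatrix ℕ)ˣ) * b)
      = RCFMatrix.block n (g : (RCFMatrix ℕ)ˣ) * RCFMatrix.block n b := by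
  classical
  have hg : (((g : (RCFMatrix ℕ)ˣ) : RCFMatrix ℕ) - 1) ∈ RCFMatrix.finMat ℕ := g.2
  rw [RCFMatrix.mem_finMat] at hg
  obtain ⟨N, hN⟩ := (hg.image Prod.snd).bddAbove
  filter_upwards [Filter.eventually_gt_atTop N] with n hn
  ext i j
  have key : ∀ k, ((g : (RCFMatrix ℕ)ˣ) : RCFMatrix ℕ).entry i k ≠ 0 → k ∈ Finset.range n := by
    intro k hk
    rw [Finset.mem_range]
    by_contra hkn
    have h0 : (((g : (RCFMatrix ℕ)ˣ) : RCFMatrix ℕ) - 1).entry i k = 0 := by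
      by_contra h
      have := hN ⟨((i : ℕ), k), h, rfl⟩
      dsimp only at this
      omega
    have h1 : (1 : RCFMatrix ℕ).entry i k = 0 := by
      refine if_neg fun e => ?_
      have e' : (i : ℕ) = k := e
      omega
    rw [sub_eq_add_neg, RCFMatrix.add_entry, RCFMatrix.neg_entry, h1] at h0
    exact hk (by simpa using h0)
  rw [Matrix.mul_apply]
  change (((g : (RCFMatrix ℕ)ˣ) : RCFMatrix ℕ) * b).entry i j = _
  rw [RCFMatrix.mul_entry_of_row _ _ _ _ _ key, Finset.sum_range]
  rfl

/-- `SL_∞(ℤ)`: the subgroup of `GL_∞(ℤ)` of matrices of determinant `1`. The determinant of a matrix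
that differs from the identity at only finitely many places is the common determinant of all its
sufficiently large upper left blocks. -/
def SLInf : Subgroup GLInf where
  carrier := {g | ∀ᶠ n in Filter.atTop,
    (RCFMatrix.block n ((g : (RCFMatrix ℕ)ˣ) : RCFMatrix ℕ)).det = 1}
  one_mem' := by
    refine Filter.Eventually.of_forall fun n => ?_
    change (RCFMatrix.block n 1).det = 1
    rw [RCFMatrix.block_one, Matrix.det_one]
  mul_mem' {g h} hg hh := by
    filter_upwards [hg, hh, GLInf.eventually_block_mul g ((h : (RCFMatrix ℕ)ˣ) : RCFMatrix ℕ)]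
      with n h1 h2 h3
    change (RCFMatrix.block n ((g : (RCFMatrix ℕ)ˣ) * ((h : (RCFMatrix ℕ)ˣ) : RCFMatrix ℕ))).det = 1
    rw [h3, Matrix.det_mul, h1, h2, mul_one]
  inv_mem' {g} hg := by
    filter_upwards [hg,
      GLInf.eventually_block_mul g (((g : (RCFMatrix ℕ)ˣ)⁻¹ : (RCFMatrix ℕ)ˣ) : RCFMatrix ℕ)]
      with n h1 h2
    rw [Units.mul_inv, RCFMatrix.block_one] at h2
    have h3 := congrArg Matrix.det h2
    rw [Matrix.det_one, Matrix.det_mul, h1, one_mul] at h3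
    exact h3.symm

/-! Number the set S × {1,2,3,4} by ℕ, so that 4 × 4 matrices over Mat_S(ℤ) become ℕ × ℕ matrices.
Through (f, m) ↦ φ₀(f) + m the Steinberg group acts by infinite matrices, and e_ij(E_{s,t}) becomes
1 + E_{ab} with a = (s,i) and b = (t,j). The image of r̃(E) is the fourth power of a quarter turn,
hence trivial, so the action descends to Γ₀. It maps Δ₀ onto the group generated by all 1 + E_{ab}
(`range_Delta₀`), and this is SL_∞(ℤ) by the Euclidean algorithm (`range_SLInf`). What remains is
injectivity on Δ₀.

The elements e_ij(E_{s,t}) only cover pairs a, b in different blocks. With four blocks there is room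
to define the missing x_{ab} as commutators and to verify all Steinberg relations over ℤ
(`BlockSteinbergFamily.steinbergFamily`). The relation r̃(E) = 1 says w_{ab}⁴ = 1 for one Weyl
element, and the Weyl elements are conjugate up to inversion, so it holds for all of them.
Injectivity thus becomes the classical presentation of SL_n(ℤ) by Steinberg relations and w⁴ = 1
(`SpecialLinearFamily.eq_one_of_columns_eq`).

For the presentation, let P be the subgroup generated by the x_{ab} with b ≠ β. An equivariant map F
from non-zero integer vectors to cosets of P with F(e_β) = P forces every h that fixes e_β into P.
The map F follows the Euclidean algorithm down to a coordinate axis, where Weyl elements prescribe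
its values. Its equivariance (`euclideanExtension_shear`) is an induction on the ℓ¹-norm. Competing
reductions are compared by diamonds and pentagons coming from the Steinberg relations
(`confluent_of_not_opposite`), or, for x_{ab} against x_{ba}, by the values on the axes. A step that
does not raise the norm but is not Euclidean is rerouted by the braid relation
(`euclideanExtension_shear_of_lt`). Finally P splits as a row group times the group on one index
fewer, and induction on the index set finishes. -/

open scoped commutatorElement

/-! ### Steinberg relations over ℤ and commutator identities. -/

/-- A family of elements `x a b` of a group that satisfies the Steinberg relations over `ℤ`. -/
structure SteinbergFamily {I H : Type*} [Group H] (x : I → I → H) : Prop where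
  mul : ∀ a b c, a ≠ b → b ≠ c → a ≠ c → ⁅x a b, x b c⁆ = x a c
  comm : ∀ a b c d, a ≠ b → c ≠ d → b ≠ c → a ≠ d → Commute (x a b) (x c d)

section Commutators

variable {H : Type*} [Group H]

theorem mul_eq_of_commutatorElement_eq {g h z : H} (e : ⁅g, h⁆ = z) : g * h = z * h * g := by
  rw [← e, commutatorElement_def]; group

/-- Collection in a Heisenberg group: z is central in ⟨g, h⟩, so the commutator is bilinear in the
exponents. -/
theorem zpow_mul_zpow_of_commutatorElement_eq {g h z : H} (e : ⁅g, h⁆ = z) (hg : Commute z g)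
    (hh : Commute z h) (m n : ℤ) : g ^ m * h ^ n = z ^ (m * n) * h ^ n * g ^ m := by
  have h1 : g * h ^ n * g⁻¹ = z ^ n * h ^ n := by
    rw [← conj_zpow, mul_eq_of_commutatorElement_eq e, mul_inv_cancel_right, hh.mul_zpow]
  have h2 : (h ^ n)⁻¹ * g * h ^ n = z ^ n * g := by
    have : g * h ^ n = z ^ n * h ^ n * g := by rw [← h1]; group
    rw [mul_assoc, this, (hh.zpow_zpow n n).eq]; group
  have h3 : (h ^ n)⁻¹ * g ^ m * h ^ n = z ^ (n * m) * g ^ m := by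
    have h4 := conj_zpow (i := m) (a := (h ^ n)⁻¹) (b := g)
    rw [inv_inv] at h4
    rw [← h4, h2, (hg.zpow_left n).mul_zpow, zpow_mul]
  have h5 : g ^ m * h ^ n = h ^ n * (z ^ (n * m) * g ^ m) := by rw [← h3]; group
  rw [h5, ← mul_assoc, ← (hh.zpow_zpow (n * m) n).eq, mul_comm n m]

/-- Each variable stands for the root element with those two indices. Conjugation by `ab` fixes `ec`
and turns `be` into `ae * be`, so its effect on `bc` can be read off from the commutator that
expresses `bc` through the auxiliary index e. -/
theorem commutatorElement_eq_of_left {ab be ec ae bc ac : H} (hbc : ⁅be, ec⁆ = bc)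
    (hae : ⁅ab, be⁆ = ae) (hac : ⁅ae, ec⁆ = ac) (h1 : Commute ab ec) (h2 : Commute ae bc)
    (h3 : Commute ac bc) : ⁅ab, bc⁆ = ac := by
  have e1 : ab * bc * ab⁻¹ = ac * bc := by
    have e2 : ab * bc * ab⁻¹ = ⁅ab * be * ab⁻¹, ab * ec * ab⁻¹⁆ := by
      rw [← hbc, conjugate_commutatorElement]
    rw [e2, h1.eq, mul_inv_cancel_right, mul_eq_of_commutatorElement_eq hae, mul_inv_cancel_right]
    have e3 : ⁅ae * be, ec⁆ = ae * ⁅be, ec⁆ * ae⁻¹ * ⁅ae, ec⁆ := by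
      simp only [commutatorElement_def]; group
    rw [e3, hbc, hac, h2.eq, mul_inv_cancel_right, h3.eq]
  rw [commutatorElement_def, e1, mul_inv_cancel_right]

/-- The mirror image: now the left entry is a commutator through f, and conjugation by `be` fixes
`af` and turns `fb` into `fe⁻¹ * fb`. -/
theorem commutatorElement_eq_of_right {ab af fb be fe ae : H} (hab : ⁅af, fb⁆ = ab)
    (hfe : ⁅fb, be⁆ = fe) (hae : ⁅af, fe⁆ = ae) (h1 : Commute af be) (h2 : Commute fe ab)
    (h5 : Commute ae fe) : ⁅ab, be⁆ = ae := by
  have e1 : be * ab * be⁻¹ = ae⁻¹ * ab := by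
    have e2 : be * ab * be⁻¹ = ⁅be * af * be⁻¹, be * fb * be⁻¹⁆ := by
      rw [← hab, conjugate_commutatorElement]
    have e4 : be * fb * be⁻¹ = fe⁻¹ * fb := by
      have := mul_eq_of_commutatorElement_eq hfe
      rw [mul_inv_eq_iff_eq_mul, mul_assoc, this]; group
    have e5 : af * fe = ae * fe * af := mul_eq_of_commutatorElement_eq hae
    have e6 : ⁅af, fe⁻¹ * fb⁆ = (af * fe⁻¹ * af⁻¹ * fe) * (fe⁻¹ * ⁅af, fb⁆ * fe) := by
      simp only [commutatorElement_def]; group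
    have e7 : af * fe⁻¹ * af⁻¹ * fe = ae⁻¹ := by
      have : af * fe * af⁻¹ = ae * fe := by rw [e5]; group
      have h' : af * fe⁻¹ * af⁻¹ = (ae * fe)⁻¹ := by rw [← this]; group
      rw [h', h5.eq]; group
    rw [e2, ← h1.eq, mul_inv_cancel_right, e4, e6, e7, hab, mul_assoc fe⁻¹, ← h2.eq]; group
  have e8 : be * ab⁻¹ * be⁻¹ = ab⁻¹ * ae := by
    have : be * ab⁻¹ * be⁻¹ = (be * ab * be⁻¹)⁻¹ := by group
    rw [this, e1]; group
  have e9 : ⁅ab, be⁆ = ab * (be * ab⁻¹ * be⁻¹) := by rw [commutatorElement_def]; group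
  rw [e9, e8]; group

end Commutators

namespace SteinbergFamily

variable {I H : Type*} [Group H] {x : I → I → H}

theorem zpow_mul_zpow (hx : SteinbergFamily x) {a b c : I} (hab : a ≠ b) (hbc : b ≠ c)
    (hac : a ≠ c) (m n : ℤ) :
    x a b ^ m * x b c ^ n = x a c ^ (m * n) * x b c ^ n * x a b ^ m :=
  zpow_mul_zpow_of_commutatorElement_eq (hx.mul a b c hab hbc hac)
    (hx.comm a c a b hac hab hac.symm hab) (hx.comm a c b c hac hbc hbc.symm hac) m n

theorem comp (hx : SteinbergFamily x) {J : Type*} (f : J → I) (hf : Function.Injective f) :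
    SteinbergFamily fun a b => x (f a) (f b) where
  mul _ _ _ hab hbc hac := hx.mul _ _ _ (hf.ne hab) (hf.ne hbc) (hf.ne hac)
  comm _ _ _ _ hab hcd hbc had := hx.comm _ _ _ _ (hf.ne hab) (hf.ne hcd) (hf.ne hbc) (hf.ne had)

end SteinbergFamily

/-! ### Weyl elements. -/

/-- The element `x_{ab} x_{ba}⁻¹ x_{ab}`; it acts on the coordinates `a` and `b` as a quarter turn. -/
def weyl {I H : Type*} [Group H] (x : I → I → H) (a b : I) : H := x a b * (x b a)⁻¹ * x a b

namespace SteinbergFamily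

variable {I H : Type*} [Group H] {x : I → I → H}

/-- With a third index c, conjugation by w_{ab} only needs Heisenberg collection: x_{bc} is moved
left through the three factors of w_{ab}, and the surplus terms cancel. The other formulas with a
third index go the same way. -/
theorem weyl_conj_target (hx : SteinbergFamily x) {a b c : I} (hab : a ≠ b) (hac : a ≠ c)
    (hbc : b ≠ c) : weyl x a b * x b c * (weyl x a b)⁻¹ = x a c := by
  have h1 := hx.zpow_mul_zpow hab hbc hac 1 1
  have h2 := hx.zpow_mul_zpow hab.symm hac hbc (-1) 1
  have h3 := (hx.comm a c b c hac hbc hbc.symm hac).eq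
  have h4 := (hx.comm a b a c hab hac hab.symm hac).eq
  have h5 := (hx.comm b a b c hab.symm hbc hab hbc).inv_left.eq
  simp only [zpow_one, mul_one, zpow_neg] at h1 h2
  rw [mul_inv_eq_iff_eq_mul, weyl]
  calc x a b * (x b a)⁻¹ * x a b * x b c
      = x a b * ((x b a)⁻¹ * x a c) * x b c * x a b := by rw [mul_assoc _ _ (x b c), h1]; group
    _ = x a b * (x b c)⁻¹ * x a c * ((x b a)⁻¹ * x b c) * x a b := by rw [h2]; group
    _ = x a b * (x b c)⁻¹ * (x a c * x b c) * (x b a)⁻¹ * x a b := by rw [h5]; group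
    _ = (x a b * x a c) * (x b a)⁻¹ * x a b := by rw [h3]; group
    _ = x a c * (x a b * (x b a)⁻¹ * x a b) := by rw [h4]; group

theorem weyl_conj_source (hx : SteinbergFamily x) {a b c : I} (hab : a ≠ b) (hac : a ≠ c)
    (hbc : b ≠ c) : weyl x a b * x c b * (weyl x a b)⁻¹ = x c a := by
  have h1 := hx.zpow_mul_zpow hac.symm hab hbc.symm 1 1
  have h2 := hx.zpow_mul_zpow hbc.symm hab.symm hac.symm 1 (-1)
  have h3 := (hx.comm c a c b hac.symm hbc.symm hac hbc.symm).eq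
  have h4 := (hx.comm a b c b hab hbc.symm hbc hab).eq
  have h5 := (hx.comm b a c a hab.symm hac.symm hac hab.symm).inv_left.eq
  simp only [zpow_one, one_mul, mul_one, zpow_neg] at h1 h2
  have h6 : (x b a)⁻¹ * x c b = x c a * x c b * (x b a)⁻¹ := by rw [mul_assoc, h2]; group
  have h7 : x a b * x c a = (x c b)⁻¹ * x c a * x a b := by
    have : x c a * x a b = x c b * (x a b * x c a) := by rw [h1]; group
    rw [mul_assoc, this]; group
  rw [mul_inv_eq_iff_eq_mul, weyl]
  calc x a b * (x b a)⁻¹ * x a b * x c b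
      = x a b * ((x b a)⁻¹ * x c b) * x a b := by rw [mul_assoc _ _ (x c b), h4]; group
    _ = (x a b * x c a) * x c b * (x b a)⁻¹ * x a b := by rw [h6]; group
    _ = (x c b)⁻¹ * x c a * (x a b * x c b) * (x b a)⁻¹ * x a b := by rw [h7]; group
    _ = (x c b)⁻¹ * (x c a * x c b) * x a b * (x b a)⁻¹ * x a b := by rw [h4]; group
    _ = x c a * (x a b * (x b a)⁻¹ * x a b) := by rw [h3]; group

theorem commute_weyl (hx : SteinbergFamily x) {a b c d : I} (hab : a ≠ b) (hcd : c ≠ d)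
    (hac : a ≠ c) (hbc : b ≠ c) (had : a ≠ d) (hbd : b ≠ d) : Commute (weyl x a b) (x c d) :=
  (((hx.comm a b c d hab hcd hbc had).mul_left
    (hx.comm b a c d hab.symm hcd hac hbd).inv_left).mul_left (hx.comm a b c d hab hcd hbc had))

end SteinbergFamily

namespace SteinbergFamily

variable {I H : Type*} [Group H] {x : I → I → H}

theorem weyl_conj_target_neg (hx : SteinbergFamily x) {a b c : I} (hab : a ≠ b) (hac : a ≠ c)
    (hbc : b ≠ c) : weyl x a b * x a c * (weyl x a b)⁻¹ = (x b c)⁻¹ := by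
  have h1 := hx.zpow_mul_zpow hab hbc hac 1 (-1)
  have h2 := hx.zpow_mul_zpow hab.symm hac hbc (-1) 1
  have h3 := (hx.comm a c b c hac hbc hbc.symm hac).eq
  have h4 := (hx.comm a b a c hab hac hab.symm hac).eq
  simp only [zpow_one, one_mul, mul_one, zpow_neg] at h1 h2
  rw [mul_inv_eq_iff_eq_mul, weyl]
  calc x a b * (x b a)⁻¹ * x a b * x a c
      = x a b * ((x b a)⁻¹ * x a c) * x a b := by rw [mul_assoc _ _ (x a c), h4]; group
    _ = (x a b * (x b c)⁻¹) * x a c * (x b a)⁻¹ * x a b := by rw [h2]; group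
    _ = (x a c)⁻¹ * (x b c)⁻¹ * (x a b * x a c) * (x b a)⁻¹ * x a b := by rw [h1]; group
    _ = (x b c * x a c)⁻¹ * x a c * x a b * (x b a)⁻¹ * x a b := by rw [h4]; group
    _ = (x b c)⁻¹ * (x a b * (x b a)⁻¹ * x a b) := by rw [← h3]; group

theorem weyl_conj_source_neg (hx : SteinbergFamily x) {a b c : I} (hab : a ≠ b) (hac : a ≠ c)
    (hbc : b ≠ c) : weyl x a b * x c a * (weyl x a b)⁻¹ = (x c b)⁻¹ := by
  have h1 := hx.zpow_mul_zpow hac.symm hab hbc.symm 1 1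
  have h2 := hx.zpow_mul_zpow hbc.symm hab.symm hac.symm (-1) (-1)
  have h3 := (hx.comm c a c b hac.symm hbc.symm hac hbc.symm).eq
  have h4 := (hx.comm a b c b hab hbc.symm hbc hab).eq
  have h5 := (hx.comm b a c a hab.symm hac.symm hac hab.symm).inv_left.eq
  simp only [zpow_one, mul_one, zpow_neg, neg_mul_neg] at h1 h2
  have h6 : (x b a)⁻¹ * (x c b)⁻¹ = (x c a)⁻¹ * (x c b)⁻¹ * (x b a)⁻¹ := by
    rw [mul_assoc, h2]; group
  have h7 : x a b * x c a = (x c b)⁻¹ * x c a * x a b := by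
    have : x c a * x a b = x c b * (x a b * x c a) := by rw [h1]; group
    rw [mul_assoc, this]; group
  rw [mul_inv_eq_iff_eq_mul, weyl]
  calc x a b * (x b a)⁻¹ * x a b * x c a
      = x a b * ((x b a)⁻¹ * (x c b)⁻¹) * x c a * x a b := by rw [mul_assoc _ _ (x c a), h7]; group
    _ = x a b * (x c a)⁻¹ * (x c b)⁻¹ * ((x b a)⁻¹ * x c a) * x a b := by rw [h6]; group
    _ = x a b * (x c b * x c a)⁻¹ * x c a * (x b a)⁻¹ * x a b := by rw [h5]; group
    _ = (x c b)⁻¹ * (x c b * x a b) * (x c b)⁻¹ * (x b a)⁻¹ * x a b := by rw [← h3]; group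
    _ = (x c b)⁻¹ * (x a b * (x b a)⁻¹ * x a b) := by rw [← h4]; group

/-- No Steinberg relation links x_{ab} with x_{ba}. So x_{ab} is written as [x_{ac}, x_{cb}], and
both factors conjugate by the formulas with a third index. -/
theorem weyl_conj_self (hx : SteinbergFamily x) {a b c : I} (hab : a ≠ b) (hac : a ≠ c)
    (hbc : b ≠ c) : weyl x a b * x a b * (weyl x a b)⁻¹ = (x b a)⁻¹ := by
  have h := hx.zpow_mul_zpow hbc hac.symm hab.symm (-1) 1
  simp only [mul_one, zpow_neg, zpow_one] at h
  rw [← hx.mul a c b hac hbc.symm hab, conjugate_commutatorElement,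
    hx.weyl_conj_target_neg hab hac hbc, hx.weyl_conj_source hab hac hbc, commutatorElement_def, h]
  group

/-- The braid relation, given a third index. -/
theorem weyl_symm_of_ne (hx : SteinbergFamily x) {a b c : I} (hab : a ≠ b) (hac : a ≠ c)
    (hbc : b ≠ c) : weyl x b a = (weyl x a b)⁻¹ := by
  have h := mul_inv_eq_iff_eq_mul.1 (hx.weyl_conj_self hab hac hbc)
  rw [eq_inv_iff_mul_eq_one]
  -- Expanding the middle w_{ab} on the right gives x_{ba}⁻¹ x_{ab} x_{ba}⁻¹, the inverse of w_{ba}.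
  have h' : weyl x a b = (x b a)⁻¹ * weyl x a b * (x a b)⁻¹ := by rw [← h]; group
  rw [h']
  simp only [weyl]
  group

end SteinbergFamily

/-! ### Families with the braid relation and w⁴ = 1. -/

/-- A Steinberg family over `ℤ` in which `w_{ba} = w_{ab}⁻¹` and `w_{ab}⁴ = 1`. -/
structure SpecialLinearFamily {I H : Type*} [Group H] (x : I → I → H) : Prop
    extends SteinbergFamily x where
  weyl_symm : ∀ a b, a ≠ b → weyl x b a = (weyl x a b)⁻¹
  weyl_pow_four : ∀ a b, a ≠ b → weyl x a b ^ 4 = 1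

theorem SteinbergFamily.weyl_conj_weyl {I H : Type*} [Group H] {x : I → I → H}
    (hx : SteinbergFamily x) {a b c : I} (hab : a ≠ b) (hac : a ≠ c) (hbc : b ≠ c) :
    weyl x a b * weyl x b c * (weyl x a b)⁻¹ = weyl x a c := by
  have h1 := hx.weyl_conj_target hab hac hbc
  have h2 := hx.weyl_conj_source hab hac hbc
  rw [weyl.eq_def x a c, ← h1, ← h2, weyl.eq_def x b c]; group

theorem SteinbergFamily.weyl_conj_weyl_neg {I H : Type*} [Group H] {x : I → I → H}
    (hx : SteinbergFamily x) {a b c : I} (hab : a ≠ b) (hac : a ≠ c) (hbc : b ≠ c) :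
    weyl x a b * weyl x a c * (weyl x a b)⁻¹ = (weyl x b c)⁻¹ := by
  have h1 := hx.weyl_conj_target_neg hab hac hbc
  have h2 := hx.weyl_conj_source_neg hab hac hbc
  have h3 : (weyl x b c)⁻¹ = (x b c)⁻¹ * ((x c b)⁻¹)⁻¹ * (x b c)⁻¹ := by
    rw [weyl.eq_def x b c]; group
  rw [h3, ← h1, ← h2, weyl.eq_def x a c]; group

/-- Changing one index conjugates a Weyl element and swapping the two inverts it, so triviality of
one fourth power spreads to all pairs. Infinitely many indices guarantee the third index needed for
both operations. -/
theorem SteinbergFamily.specialLinearFamily {I H : Type*} [Group H] [Infinite I] {x : I → I → H}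
    (hx : SteinbergFamily x) {p q : I} (hpq : p ≠ q) (h4 : weyl x p q ^ 4 = 1) :
    SpecialLinearFamily x := by
  classical
  have third (a b : I) : ∃ c, a ≠ c ∧ b ≠ c := by
    obtain ⟨c, hc⟩ := Infinite.exists_notMem_finset {a, b}
    simp only [Finset.mem_insert, Finset.mem_singleton, not_or] at hc
    exact ⟨c, Ne.symm hc.1, Ne.symm hc.2⟩
  have symm (a b : I) (hab : a ≠ b) : weyl x b a = (weyl x a b)⁻¹ := by
    obtain ⟨c, hac, hbc⟩ := third a b
    exact hx.weyl_symm_of_ne hab hac hbc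
  have target {a b c : I} (hab : a ≠ b) (hac : a ≠ c) (hbc : b ≠ c)
      (h : weyl x b c ^ 4 = 1) : weyl x a c ^ 4 = 1 := by
    rw [← hx.weyl_conj_weyl hab hac hbc, conj_pow, h]; group
  have swap {a b : I} (hab : a ≠ b) (h : weyl x a b ^ 4 = 1) : weyl x b a ^ 4 = 1 := by
    rw [symm a b hab, inv_pow, h, inv_one]
  have target' {a b c : I} (hac : a ≠ c) (hbc : b ≠ c)
      (h : weyl x b c ^ 4 = 1) : weyl x a c ^ 4 = 1 := by
    by_cases hab : a = b
    · rwa [hab]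
    · exact target hab hac hbc h
  refine ⟨hx, symm, fun a b hab => ?_⟩
  obtain ⟨c, hac, hqc⟩ := third a q
  have h1 := target' hqc.symm hpq h4
  have h2 := swap hqc.symm h1
  have h3 := target' hac hqc h2
  have h4 := swap hac h3
  have h5 : weyl x b a ^ 4 = 1 := target' hab.symm hac.symm h4
  exact swap hab.symm h5

namespace SpecialLinearFamily

variable {I H : Type*} [Group H] {x : I → I → H}

theorem braid (hx : SpecialLinearFamily x) {a b : I} (hab : a ≠ b) :
    x a b * (x b a)⁻¹ * x a b = (x b a)⁻¹ * x a b * (x b a)⁻¹ := by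
  have h := hx.weyl_symm b a hab.symm
  rw [weyl, weyl] at h
  rw [h]; group

theorem braid_units (hx : SpecialLinearFamily x) {a b : I} (hab : a ≠ b) (ε : ℤˣ) :
    x a b ^ (ε : ℤ) * (x b a ^ (ε : ℤ))⁻¹ * x a b ^ (ε : ℤ)
      = (x b a ^ (ε : ℤ))⁻¹ * x a b ^ (ε : ℤ) * (x b a ^ (ε : ℤ))⁻¹ := by
  rcases Int.units_eq_one_or ε with rfl | rfl
  · simpa using hx.braid hab
  · have := congrArg (·⁻¹) (hx.braid hab)
    simpa [mul_assoc] using this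

theorem weyl_conj_self (hx : SpecialLinearFamily x) {a b : I} (hab : a ≠ b) :
    weyl x a b * x a b * (weyl x a b)⁻¹ = (x b a)⁻¹ := by
  rw [mul_inv_eq_iff_eq_mul]
  nth_rw 1 [weyl]
  rw [hx.braid hab, weyl]; group

theorem weyl_conj_opp (hx : SpecialLinearFamily x) {a b : I} (hab : a ≠ b) :
    weyl x a b * x b a * (weyl x a b)⁻¹ = (x a b)⁻¹ := by
  rw [mul_inv_eq_iff_eq_mul]
  nth_rw 1 [weyl]
  rw [hx.braid hab, weyl]; group

/-- The Weyl element acts on the root elements as a signed transposition. The sign is left as an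
unspecified exponent, because only membership in subgroups is read off from it. -/
theorem exists_weyl_conj [DecidableEq I] (hx : SpecialLinearFamily x) {a b p q : I} (hab : a ≠ b)
    (hpq : p ≠ q) : ∃ s : ℤ, weyl x a b * x p q * (weyl x a b)⁻¹
      = x (Equiv.swap a b p) (Equiv.swap a b q) ^ s := by
  by_cases hpa : p = a
  · subst hpa
    by_cases hqb : q = b
    · subst hqb
      exact ⟨-1, by simpa using hx.weyl_conj_self hab⟩
    · refine ⟨-1, ?_⟩
      rw [Equiv.swap_apply_left, Equiv.swap_apply_of_ne_of_ne hpq.symm hqb, zpow_neg_one]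
      exact hx.weyl_conj_target_neg hab hpq (Ne.symm hqb)
  by_cases hpb : p = b
  · subst hpb
    by_cases hqa : q = a
    · subst hqa
      exact ⟨-1, by simpa using hx.weyl_conj_opp hab⟩
    · refine ⟨1, ?_⟩
      rw [Equiv.swap_apply_right, Equiv.swap_apply_of_ne_of_ne hqa hpq.symm, zpow_one]
      exact hx.weyl_conj_target hab (Ne.symm hqa) hpq
  rw [Equiv.swap_apply_of_ne_of_ne hpa hpb]
  by_cases hqa : q = a
  · subst hqa
    refine ⟨-1, ?_⟩
    rw [Equiv.swap_apply_left, zpow_neg_one]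
    exact hx.weyl_conj_source_neg hab (Ne.symm hpa) (Ne.symm hpb)
  by_cases hqb : q = b
  · subst hqb
    refine ⟨1, ?_⟩
    rw [Equiv.swap_apply_right, zpow_one]
    exact hx.weyl_conj_source hab (Ne.symm hpa) (Ne.symm hpb)
  refine ⟨1, ?_⟩
  rw [Equiv.swap_apply_of_ne_of_ne hqa hqb, zpow_one, (hx.commute_weyl hab hpq (Ne.symm hpa)
    (Ne.symm hpb) (Ne.symm hqa) (Ne.symm hqb)).eq, mul_inv_cancel_right]

/-- A restriction may leave only two indices, where the Steinberg relations say nothing about x_{ab}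
and x_{ba}. This is why the braid relation is part of the structure. -/
theorem comp (hx : SpecialLinearFamily x) {J : Type*} (f : J → I) (hf : Function.Injective f) :
    SpecialLinearFamily fun a b => x (f a) (f b) where
  toSteinbergFamily := hx.toSteinbergFamily.comp f hf
  weyl_symm _ _ h := hx.weyl_symm _ _ (hf.ne h)
  weyl_pow_four _ _ h := hx.weyl_pow_four _ _ (hf.ne h)

end SpecialLinearFamily

/-! ### The Euclidean algorithm on integer vectors. -/

section Shear

variable {ι : Type*}

/-- The step `x_{ab}^ε` is a step of the Euclidean algorithm on `v`. -/
structure Reduces (a b : ι) (ε : ℤˣ) (v : ι → ℤ) : Prop where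
  ne : a ≠ b
  ne_zero : v b ≠ 0
  natAbs : (v a + ε * v b).natAbs + (v b).natAbs = (v a).natAbs

theorem exists_reduces {a b : ι} (v : ι → ℤ) (hab : a ≠ b) (hb : v b ≠ 0)
    (h : (v b).natAbs ≤ (v a).natAbs) : ∃ ε, Reduces a b ε v := by
  by_cases h' : (v a + v b).natAbs + (v b).natAbs = (v a).natAbs
  · exact ⟨1, hab, hb, by simpa using h'⟩
  · refine ⟨-1, hab, hb, ?_⟩
    simp only [Units.val_neg, Units.val_one, neg_mul, one_mul]
    omega

variable [DecidableEq ι]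

/-- The action of `x_{ab}ⁿ` on a column vector: add `n` times the entry `b` to the entry `a`. -/
def shear (a b : ι) (n : ℤ) (v : ι → ℤ) : ι → ℤ := Function.update v a (v a + n * v b)

theorem shear_apply_self (a b : ι) (n : ℤ) (v : ι → ℤ) : shear a b n v a = v a + n * v b := by
  simp [shear]

theorem shear_apply_of_ne {a c : ι} (b : ι) (n : ℤ) (v : ι → ℤ) (h : c ≠ a) :
    shear a b n v c = v c := by
  simp [shear, h]

theorem shear_neg_shear {a b : ι} (h : a ≠ b) (n : ℤ) (v : ι → ℤ) :
    shear a b (-n) (shear a b n v) = v := by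
  ext c
  by_cases hc : c = a
  · subst hc
    rw [shear_apply_self, shear_apply_self, shear_apply_of_ne _ _ _ h.symm]; ring
  · rw [shear_apply_of_ne _ _ _ hc, shear_apply_of_ne _ _ _ hc]

theorem shear_of_eq_zero (a : ι) {b : ι} (n : ℤ) {v : ι → ℤ} (h : v b = 0) : shear a b n v = v := by
  simp [shear, h]

theorem shear_ne_zero {a b : ι} (h : a ≠ b) (n : ℤ) {v : ι → ℤ} (hv : v ≠ 0) :
    shear a b n v ≠ 0 := by
  intro h0
  apply hv
  rw [← shear_neg_shear h n v, h0]
  ext c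
  simp [shear]

theorem shear_comm {a b c d : ι} (hbc : b ≠ c) (had : a ≠ d) (m n : ℤ) (v : ι → ℤ) :
    shear a b m (shear c d n v) = shear c d n (shear a b m v) := by
  ext e
  simp only [shear, Function.update_apply]
  grind

theorem shear_shear {a b d : ι} (hab : a ≠ b) (hbd : b ≠ d) (had : a ≠ d) (m n : ℤ) (v : ι → ℤ) :
    shear a b m (shear b d n v) = shear a d (m * n) (shear b d n (shear a b m v)) := by
  ext e
  simp only [shear, Function.update_apply]
  grind

theorem not_reduces_single (e : ι) (m : ℤ) (a b : ι) (ε : ℤˣ) :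
    ¬ Reduces a b ε (Pi.single e m) := by
  intro h
  have h1 := h.ne
  have h2 := h.ne_zero
  have h3 := h.natAbs
  by_cases hb : b = e
  · subst hb
    rw [Pi.single_eq_of_ne h1, Pi.single_eq_same] at h3
    rw [Pi.single_eq_same] at h2
    omega
  · exact h2 (Pi.single_eq_of_ne hb _)

/-- Of two non-zero entries, the smaller one reduces the larger. The algorithm therefore stops only
on the coordinate axes. -/
theorem exists_reduces_or_eq_single {v : ι → ℤ} (hv : v ≠ 0) :
    (∃ a b ε, Reduces a b ε v) ∨ ∃ a m, m ≠ 0 ∧ v = Pi.single a m := by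
  obtain ⟨a, ha⟩ := Function.ne_iff.1 hv
  rw [Pi.zero_apply] at ha
  by_cases h : ∃ b, b ≠ a ∧ v b ≠ 0
  · obtain ⟨b, hba, hb⟩ := h
    left
    rcases le_total (v b).natAbs (v a).natAbs with h | h
    · obtain ⟨ε, h⟩ := exists_reduces v hba.symm hb h
      exact ⟨_, _, _, h⟩
    · obtain ⟨ε, h⟩ := exists_reduces v hba ha h
      exact ⟨_, _, _, h⟩
  · right
    push Not at h
    refine ⟨a, v a, ha, funext fun b => ?_⟩
    by_cases hb : b = a
    · subst hb; simp
    · rw [h b hb, Pi.single_eq_of_ne hb]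

variable [Fintype ι]

/-- The `ℓ¹`-norm of an integer vector. -/
def l1 (v : ι → ℤ) : ℕ := ∑ i, (v i).natAbs

theorem l1_shear (a b : ι) (n : ℤ) (v : ι → ℤ) :
    l1 (shear a b n v) + (v a).natAbs = l1 v + (v a + n * v b).natAbs := by
  simp only [l1]
  rw [← Finset.add_sum_erase _ _ (Finset.mem_univ a),
    ← Finset.add_sum_erase _ (fun i => (v i).natAbs) (Finset.mem_univ a), shear_apply_self]
  have : ∑ i ∈ Finset.univ.erase a, (shear a b n v i).natAbs
      = ∑ i ∈ Finset.univ.erase a, (v i).natAbs :=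
    Finset.sum_congr rfl fun i hi => by rw [shear_apply_of_ne _ _ _ (Finset.ne_of_mem_erase hi)]
  omega

theorem Reduces.l1_lt {a b : ι} {ε : ℤˣ} {v : ι → ℤ} (h : Reduces a b ε v) :
    l1 (shear a b ε v) < l1 v := by
  have h1 := l1_shear a b ε v
  have h2 := h.natAbs
  have h3 := h.ne_zero
  omega

end Shear

/-! ### Local confluence of Euclidean steps. -/

section Confluence

variable {ι H X : Type*} [DecidableEq ι] [Fintype ι] [Group H] [MulAction H X]

/-- `f` is equivariant along the steps that stay inside the open ball of radius `N`. -/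
def EquivariantBelow (x : ι → ι → H) (f : (ι → ℤ) → X) (N : ℕ) : Prop :=
  ∀ (v : ι → ℤ) (a b : ι) (ε : ℤˣ), v ≠ 0 → a ≠ b → l1 v < N → l1 (shear a b ε v) < N →
    f (shear a b ε v) = x a b ^ (ε : ℤ) • f v

variable {x : ι → ι → H} {f : (ι → ℤ) → X} {N : ℕ}

theorem EquivariantBelow.smul_eq (hf : EquivariantBelow x f N) {v : ι → ℤ} (hv : v ≠ 0)
    (hN : l1 v < N) {a b : ι} (hab : a ≠ b) (hb : v b = 0) (n : ℤ) : x a b ^ n • f v = f v := by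
  have h := hf v a b 1 hv hab hN (by rwa [shear_of_eq_zero _ _ hb])
  rw [shear_of_eq_zero _ _ hb, Units.val_one, zpow_one] at h
  have : x a b ∈ MulAction.stabilizer H (f v) := h.symm
  exact zpow_mem this n

/-- Closes a diamond: p and q are the values after the two competing steps, and u is the value at
the common vector below. -/
theorem inv_smul_eq_inv_smul_of_commute {p q u : X} {g k : H} (hp : u = k • p) (hq : u = g • q)
    (h : Commute g k) : g⁻¹ • p = k⁻¹ • q := by
  rw [inv_smul_eq_iff, ← mul_smul, h.inv_right.eq, mul_smul, ← hq, hp, inv_smul_smul]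

/-- Two steps of the Euclidean algorithm with different targets and no interaction. -/
theorem confluent_of_disjoint (hx : SteinbergFamily x) (hf : EquivariantBelow x f N)
    {v : ι → ℤ} (hv : v ≠ 0) (hN : l1 v = N) {a b c d : ι} {ε δ : ℤˣ}
    (h1 : Reduces a b ε v) (h2 : Reduces c d δ v) (hbc : b ≠ c) (had : a ≠ d) (hac : a ≠ c) :
    (x a b ^ (ε : ℤ))⁻¹ • f (shear a b ε v) = (x c d ^ (δ : ℤ))⁻¹ • f (shear c d δ v) := by
  have l1' := h1.l1_lt
  have l2' := h2.l1_lt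
  have hl : l1 (shear a b ε (shear c d δ v)) < N := by
    have := l1_shear a b ε (shear c d δ v)
    rw [shear_apply_of_ne _ _ _ hac, shear_apply_of_ne _ _ _ hbc] at this
    have := h1.natAbs
    omega
  refine inv_smul_eq_inv_smul_of_commute (u := f (shear a b ε (shear c d δ v))) ?_ ?_
    ((hx.comm a b c d h1.ne h2.ne hbc had).zpow_zpow _ _)
  · rw [shear_comm hbc had] at hl ⊢
    exact hf _ _ _ _ (shear_ne_zero h1.ne _ hv) h2.ne (by omega) hl
  · exact hf _ _ _ _ (shear_ne_zero h2.ne _ hv) h1.ne (by omega) hl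

/-- Two steps of the Euclidean algorithm with the same target. -/
theorem confluent_of_same_target (hx : SteinbergFamily x) (hf : EquivariantBelow x f N)
    {v : ι → ℤ} (hv : v ≠ 0) (hN : l1 v = N) {a b d : ι} {ε δ : ℤˣ}
    (h1 : Reduces a b ε v) (h2 : Reduces a d δ v) (hbd : b ≠ d) :
    (x a b ^ (ε : ℤ))⁻¹ • f (shear a b ε v) = (x a d ^ (δ : ℤ))⁻¹ • f (shear a d δ v) := by
  have hab := h1.ne
  have had := h2.ne
  have l1' := h1.l1_lt
  have l2' := h2.l1_lt
  have n1 := h1.natAbs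
  have n2 := h2.natAbs
  have z1 := h1.ne_zero
  have z2 := h2.ne_zero
  -- Making both steps leaves an entry of absolute value ||v_a| − |v_b| − |v_d||. This is less than
  -- |v_a|, so that the far corner of the square lies below N, except when |v_b| = |v_d| = |v_a|.
  by_cases hex : (v b).natAbs = (v a).natAbs ∧ (v d).natAbs = (v a).natAbs
  · have e1 : v a + ε * v b = 0 := by omega
    have e2 : v a + δ * v d = 0 := by omega
    have hu : shear a d δ v = shear a b ε v := by rw [shear, shear, e1, e2]
    rw [hu]
    set u := shear a b ε v with hu_def
    have hu0 : u ≠ 0 := shear_ne_zero hab _ hv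
    have ub : u b = v b := shear_apply_of_ne _ _ _ hab.symm
    have ud : u d = v d := shear_apply_of_ne _ _ _ had.symm
    -- In the exceptional case both steps lead to the same u. A step x_{bd} clears the entry b of u,
    -- and x_{ab} fixes the value at the resulting t. Moving x_{ab}^{-ε} back across that step
    -- produces exactly x_{ad}^δ, so x_{ad}^δ x_{ab}^{-ε} fixes f u.
    have e3 : u b + ((-(ε * δ) : ℤˣ) : ℤ) * u d = 0 := by
      rw [ub, ud]
      rcases Int.units_eq_one_or ε with rfl | rfl <;> rcases Int.units_eq_one_or δ with rfl | rfl <;>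
        simp at e1 e2 ⊢ <;> omega
    set t := shear b d ((-(ε * δ) : ℤˣ) : ℤ) u with ht_def
    have tb : t b = 0 := by rw [ht_def, shear_apply_self, e3]
    have lt : l1 t < N := by
      have := l1_shear b d ((-(ε * δ) : ℤˣ) : ℤ) u
      rw [e3, ← ht_def] at this
      simp only [Int.natAbs_zero] at this
      omega
    have h3 := hf u b d (-(ε * δ)) hu0 hbd (by omega) lt
    rw [← ht_def] at h3
    have h4 := hf.smul_eq (shear_ne_zero hbd _ hu0) lt hab tb (-(ε : ℤ))
    rw [← ht_def, h3, ← mul_smul] at h4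
    have h5 := hx.zpow_mul_zpow hab hbd had (-(ε : ℤ)) ((-(ε * δ) : ℤˣ) : ℤ)
    have h6 : (-(ε : ℤ)) * ((-(ε * δ) : ℤˣ) : ℤ) = δ := by
      rcases Int.units_eq_one_or ε with rfl | rfl <;> simp
    rw [h6] at h5
    rw [h5, mul_assoc] at h4
    have hc : Commute (x a d ^ (δ : ℤ)) (x b d ^ ((-(ε * δ) : ℤˣ) : ℤ)) :=
      (hx.comm a d b d had hbd hbd.symm had).zpow_zpow _ _
    rw [← mul_assoc, hc.eq, mul_assoc, mul_smul, smul_left_cancel_iff, mul_smul, zpow_neg] at h4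
    rw [eq_inv_smul_iff]
    exact h4
  · have hl : l1 (shear a b ε (shear a d δ v)) < N := by
      have := l1_shear a b ε (shear a d δ v)
      rw [shear_apply_self, shear_apply_of_ne _ _ _ hab.symm] at this
      have h3 := l1_shear a d δ v
      rcases Int.units_eq_one_or ε with rfl | rfl <;> rcases Int.units_eq_one_or δ with rfl | rfl <;>
        simp only [Units.val_neg, Units.val_one, neg_mul, one_mul] at * <;> omega
    refine inv_smul_eq_inv_smul_of_commute (u := f (shear a b ε (shear a d δ v))) ?_ ?_
      ((hx.comm a b a d hab had hab.symm had).zpow_zpow _ _)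
    · rw [shear_comm hab.symm had] at hl ⊢
      exact hf _ _ _ _ (shear_ne_zero hab _ hv) had (by omega) hl
    · exact hf _ _ _ _ (shear_ne_zero had _ hv) hab (by omega) hl

/-- Two steps of the Euclidean algorithm whose commutator is a third step. -/
theorem confluent_of_chain (hx : SteinbergFamily x) (hf : EquivariantBelow x f N)
    {v : ι → ℤ} (hv : v ≠ 0) (hN : l1 v = N) {a b d : ι} {ε δ : ℤˣ}
    (h1 : Reduces a b ε v) (h2 : Reduces b d δ v) (had : a ≠ d) :
    (x a b ^ (ε : ℤ))⁻¹ • f (shear a b ε v) = (x b d ^ (δ : ℤ))⁻¹ • f (shear b d δ v) := by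
  have hab := h1.ne
  have hbd := h2.ne
  have l1' := h1.l1_lt
  have l2' := h2.l1_lt
  have n1 := h1.natAbs
  have n2 := h2.natAbs
  have z1 := h1.ne_zero
  have z2 := h2.ne_zero
  have hl : l1 (shear a b ε (shear b d δ v)) < N := by
    have h3 := l1_shear a b ε (shear b d δ v)
    rw [shear_apply_self, shear_apply_of_ne _ _ _ hab] at h3
    have h4 := l1_shear b d δ v
    rcases Int.units_eq_one_or ε with rfl | rfl <;> rcases Int.units_eq_one_or δ with rfl | rfl <;>
      simp only [Units.val_neg, Units.val_one, neg_mul, one_mul] at * <;> omega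
  have hl' : l1 (shear b d δ (shear a b ε v)) < N := by
    have h3 := l1_shear b d δ (shear a b ε v)
    rw [shear_apply_of_ne _ _ _ hab.symm, shear_apply_of_ne _ _ _ had.symm] at h3
    omega
  have e1 := hf _ a b ε (shear_ne_zero hbd δ hv) hab (by omega) hl
  have e2 := hf _ b d δ (shear_ne_zero hab ε hv) hbd (by omega) hl'
  have hs := shear_shear hab hbd had ε δ v
  -- The two orders of the steps end at vectors that differ by x_{ad}^{εδ}. Both ends lie below N,
  -- so this edge closes a pentagon that matches the Heisenberg relation.
  have e3 := hf _ a d (ε * δ) (shear_ne_zero hbd δ (shear_ne_zero hab ε hv)) had hl'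
    (by rw [Units.val_mul, ← hs]; exact hl)
  rw [Units.val_mul, ← hs, e1, e2, ← mul_smul] at e3
  have h5 := hx.zpow_mul_zpow hab hbd had (ε : ℤ) δ
  rw [inv_smul_eq_iff, ← mul_smul]
  have h6 : f (shear a b ε v)
      = (x a d ^ ((ε : ℤ) * δ) * x b d ^ (δ : ℤ))⁻¹ • x a b ^ (ε : ℤ) • f (shear b d δ v) := by
    rw [e3, inv_smul_smul]
  rw [h6, ← mul_smul]
  congr 1
  rw [inv_mul_eq_iff_eq_mul, eq_comm, ← mul_assoc, ← h5]
  group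

/-- Only x_{ab} against x_{ba} escapes the Steinberg relations. If the two index pairs coincide, v_b
≠ 0 forces the signs to agree and there is nothing to compare. -/
theorem confluent_of_not_opposite (hx : SteinbergFamily x) (hf : EquivariantBelow x f N)
    {v : ι → ℤ} (hv : v ≠ 0) (hN : l1 v = N) {a b c d : ι} {ε δ : ℤˣ}
    (h1 : Reduces a b ε v) (h2 : Reduces c d δ v) (h : ¬ (b = c ∧ a = d)) :
    (x a b ^ (ε : ℤ))⁻¹ • f (shear a b ε v) = (x c d ^ (δ : ℤ))⁻¹ • f (shear c d δ v) := by
  by_cases hbc : b = c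
  · subst hbc
    exact confluent_of_chain hx hf hv hN h1 h2 fun e => h ⟨rfl, e⟩
  by_cases had : a = d
  · subst had
    exact (confluent_of_chain hx hf hv hN h2 h1 (Ne.symm hbc)).symm
  by_cases hac : a = c
  · subst hac
    by_cases hbd : b = d
    · subst hbd
      have e : ε = δ := by
        have n1 := h1.natAbs
        have n2 := h2.natAbs
        have z1 := h1.ne_zero
        rcases Int.units_eq_one_or ε with rfl | rfl <;>
          rcases Int.units_eq_one_or δ with rfl | rfl <;>
          simp only [Units.val_neg, Units.val_one, neg_mul, one_mul] at * <;> omega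
      rw [e]
    · exact confluent_of_same_target hx hf hv hN h1 h2 hbd
  · exact confluent_of_disjoint hx hf hv hN h1 h2 hbc had hac

end Confluence

/-! ### The equivariant extension along the Euclidean algorithm. -/

section Extension

variable {ι H X : Type*} [DecidableEq ι] [Group H] [MulAction H X]

/-- Values at the multiples of the standard basis vectors that are compatible with the action of
the elements `w_{ab}` and of the `x_{ab}` that fix the vector. -/
structure IsEquivariantOnAxes (x : ι → ι → H) (B : (ι → ℤ) → X) : Prop where
  weyl_smul : ∀ a b m, a ≠ b → m ≠ 0 → weyl x a b • B (Pi.single b m) = B (Pi.single a m)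
  weyl_smul_neg : ∀ a b m, a ≠ b → m ≠ 0 → weyl x a b • B (Pi.single a m) = B (Pi.single b (-m))
  smul : ∀ a b c m, a ≠ b → c ≠ b → m ≠ 0 → x a b • B (Pi.single c m) = B (Pi.single c m)

variable [Fintype ι]

open Classical in
/-- The extension of a function on the coordinate axes to all vectors along the Euclidean
algorithm. -/
noncomputable def euclideanExtension (x : ι → ι → H) (B : (ι → ℤ) → X) (v : ι → ℤ) : X :=
  if h : ∃ t : ι × ι × ℤˣ, Reduces t.1 t.2.1 t.2.2 v then
    (x h.choose.1 h.choose.2.1 ^ (h.choose.2.2 : ℤ))⁻¹ •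
      euclideanExtension x B (shear h.choose.1 h.choose.2.1 h.choose.2.2 v)
  else B v
termination_by l1 v
decreasing_by exact h.choose_spec.l1_lt

variable {x : ι → ι → H} {B : (ι → ℤ) → X} {N : ℕ}

theorem euclideanExtension_single (a : ι) (m : ℤ) :
    euclideanExtension x B (Pi.single a m) = B (Pi.single a m) := by
  rw [euclideanExtension, dif_neg]
  rintro ⟨t, ht⟩
  exact not_reduces_single _ _ _ _ _ ht

theorem exists_euclideanExtension_eq {v : ι → ℤ} (h : ∃ a b ε, Reduces a b ε v) :
    ∃ a b, ∃ ε : ℤˣ, Reduces a b ε v ∧ euclideanExtension x B v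
      = (x a b ^ (ε : ℤ))⁻¹ • euclideanExtension x B (shear a b ε v) := by
  obtain ⟨a, b, ε, h⟩ := h
  have h' : ∃ t : ι × ι × ℤˣ, Reduces t.1 t.2.1 t.2.2 v := ⟨(a, b, ε), h⟩
  refine ⟨h'.choose.1, h'.choose.2.1, h'.choose.2.2, h'.choose_spec, ?_⟩
  rw [euclideanExtension, dif_pos h']

local notation "𝓕" => euclideanExtension x B

/-- Both steps being available forces |v_a| = |v_b|. A third non-zero entry supplies an intermediate
step that is not opposite to either one. Otherwise both steps land on axes, and the prescribed
action of the Weyl elements there settles the comparison. -/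
theorem confluent_of_opposite (hx : SpecialLinearFamily x) (hB : IsEquivariantOnAxes x B)
    (hf : EquivariantBelow x 𝓕 N) {v : ι → ℤ} (hv : v ≠ 0) (hN : l1 v = N) {a b : ι} {ε δ : ℤˣ}
    (h1 : Reduces a b ε v) (h2 : Reduces b a δ v) :
    (x a b ^ (ε : ℤ))⁻¹ • 𝓕 (shear a b ε v) = (x b a ^ (δ : ℤ))⁻¹ • 𝓕 (shear b a δ v) := by
  have hab := h1.ne
  have n1 := h1.natAbs
  have n2 := h2.natAbs
  have z1 := h1.ne_zero
  have z2 := h2.ne_zero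
  have hxs := hx.toSteinbergFamily
  by_cases he : ∃ e, e ≠ a ∧ e ≠ b ∧ v e ≠ 0
  · obtain ⟨e, hea, heb, hve⟩ := he
    rcases le_total (v e).natAbs (v a).natAbs with hle | hle
    · obtain ⟨η, h3⟩ := exists_reduces v hea.symm hve hle
      exact (confluent_of_not_opposite hxs hf hv hN h1 h3 fun h => hab h.1.symm).trans
        (confluent_of_not_opposite hxs hf hv hN h3 h2 fun h => heb h.1)
    · obtain ⟨η, h3⟩ := exists_reduces v hea z2 hle
      exact (confluent_of_not_opposite hxs hf hv hN h1 h3 fun h => heb h.1.symm).trans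
        (confluent_of_not_opposite hxs hf hv hN h3 h2 fun h => hea h.2)
  · push Not at he
    have e1 : shear a b ε v = Pi.single b (v b) := by
      ext e
      by_cases hea : e = a
      · subst hea
        rw [shear_apply_self, Pi.single_eq_of_ne hab]
        omega
      · rw [shear_apply_of_ne _ _ _ hea]
        by_cases heb : e = b
        · subst heb; simp
        · rw [Pi.single_eq_of_ne heb, he e hea heb]
    have e2 : shear b a δ v = Pi.single a (v a) := by
      ext e
      by_cases heb : e = b
      · subst heb
        rw [shear_apply_self, Pi.single_eq_of_ne hab.symm]
        omega
      · rw [shear_apply_of_ne _ _ _ heb]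
        by_cases hea : e = a
        · subst hea; simp
        · rw [Pi.single_eq_of_ne hea, he e hea heb]
    rw [e1, e2, euclideanExtension_single, euclideanExtension_single]
    have hfix := hB.smul b a b (v b) hab.symm hab.symm z1
    have hfix' : (x b a)⁻¹ • B (Pi.single b (v b)) = B (Pi.single b (v b)) := by
      rw [inv_smul_eq_iff, hfix]
    -- Mixed signs are impossible. For sign 1 the factorization of w_{ba} is used, for sign −1 that
    -- of w_{ab} after the braid relation; in both, the rightmost factor fixes the axis value.
    rcases Int.units_eq_one_or ε with rfl | rfl <;>
      rcases Int.units_eq_one_or δ with rfl | rfl <;>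
      simp only [Units.val_neg, Units.val_one, neg_mul, one_mul, zpow_one, zpow_neg, inv_inv] at *
    · have h := hB.weyl_smul_neg b a (v b) hab.symm z1
      rw [weyl, mul_smul, hfix, show -v b = v a by omega] at h
      rw [← h, ← mul_smul]
      congr 1
      group
    · omega
    · omega
    · have h := hB.weyl_smul a b (v b) hab z1
      rw [weyl, hx.braid hab, mul_smul, hfix', show v b = v a by omega] at h
      rw [← h, show v b = v a by omega, ← mul_smul]
      congr 1
      group

theorem euclideanExtension_eq_of_reduces (hx : SpecialLinearFamily x)
    (hB : IsEquivariantOnAxes x B) (hf : EquivariantBelow x 𝓕 N) {v : ι → ℤ} (hv : v ≠ 0)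
    (hN : l1 v = N) {a b : ι} {ε : ℤˣ} (h : Reduces a b ε v) :
    𝓕 (shear a b ε v) = x a b ^ (ε : ℤ) • 𝓕 v := by
  obtain ⟨c, d, δ, h', e⟩ := exists_euclideanExtension_eq (x := x) (B := B) ⟨a, b, ε, h⟩
  rw [e, ← inv_smul_eq_iff]
  by_cases hc : b = c ∧ a = d
  · obtain ⟨rfl, rfl⟩ := hc
    exact confluent_of_opposite hx hB hf hv hN h h'
  · exact confluent_of_not_opposite hx.toSteinbergFamily hf hv hN h h' hc

/-- The first step x_{cd} of the algorithm keeps the entry b equal to zero, so the claim is already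
known below. Moving x_{ab} past x_{cd} costs nothing unless a = d, and then the extra factor x_{cb}
fixes the lower value as well. -/
theorem smul_euclideanExtension_of_eq_zero (hx : SpecialLinearFamily x)
    (hB : IsEquivariantOnAxes x B) (hf : EquivariantBelow x 𝓕 N) {v : ι → ℤ} (hv : v ≠ 0)
    (hN : l1 v = N) {a b : ι} (hab : a ≠ b) (hb : v b = 0) : x a b • 𝓕 v = 𝓕 v := by
  rcases exists_reduces_or_eq_single hv with h | ⟨c, m, hm, rfl⟩
  · obtain ⟨c, d, δ, h, e⟩ := exists_euclideanExtension_eq (x := x) (B := B) h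
    have n1 := h.natAbs
    have z1 := h.ne_zero
    have hcd := h.ne
    have hdb : d ≠ b := by rintro rfl; exact z1 hb
    have hcb : c ≠ b := by rintro rfl; omega
    have hl := h.l1_lt
    have hb' : shear c d δ v b = 0 := by rw [shear_apply_of_ne _ _ _ hcb.symm, hb]
    have hfix {p : ι} (hp : p ≠ b) (n : ℤ) := hf.smul_eq (shear_ne_zero hcd δ hv) (by omega) hp hb' n
    rw [e, ← mul_smul, ← inv_smul_eq_iff, mul_smul, inv_inv, ← mul_smul, ← mul_smul]
    by_cases had : a = d
    · subst had
      have h5 := hx.zpow_mul_zpow hcd hab hcb (δ : ℤ) 1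
      rw [zpow_one, mul_one] at h5
      rw [h5, mul_inv_cancel_right, mul_smul]
      have := hfix hab 1
      rw [zpow_one] at this
      rw [this, hfix hcb]
    · have hc := (hx.comm a b c d hab hcd hcb.symm had).zpow_right (δ : ℤ)
      rw [← hc.eq, mul_inv_cancel_right]
      simpa using hfix hab 1
  · rw [euclideanExtension_single]
    refine hB.smul a b c m hab ?_ hm
    rintro rfl
    exact hm (by simpa using hb)

/-- The hypotheses force p and εq to have opposite signs and |q| ≤ 2|p|. The five equations give the
sizes of the entries that change along the braid path used next. -/
theorem natAbs_of_overshoot {p q : ℤ} (ε : ℤˣ) (hlt : p.natAbs < q.natAbs)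
    (hle : (p + ε * q).natAbs ≤ p.natAbs) :
    (p + ε * q).natAbs + p.natAbs = q.natAbs ∧ (q + ε * p).natAbs + p.natAbs = q.natAbs ∧
      (p + ε * (q + ε * p)).natAbs + q.natAbs = 2 * p.natAbs ∧
      (q + ε * p + (-ε : ℤˣ) * (p + ε * (q + ε * p))).natAbs = p.natAbs ∧
      (q + (-ε : ℤˣ) * (p + ε * q)).natAbs + (p + ε * q).natAbs = q.natAbs := by
  rcases Int.units_eq_one_or ε with rfl | rfl <;>
    simp only [Units.val_neg, Units.val_one, neg_mul, one_mul, neg_neg] at * <;> omega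

/-- The step is not Euclidean, since |v_a| < |v_b|, although it does not raise the norm. By the
braid relation x_{ab}^ε = x_{ba}^ε x_{ab}^ε x_{ba}^{-ε} x_{ab}^ε x_{ba}^ε, and the vectors strictly
between the ends of this path all have norm below N. -/
theorem euclideanExtension_shear_of_lt (hx : SpecialLinearFamily x)
    (hB : IsEquivariantOnAxes x B) (hf : EquivariantBelow x 𝓕 N) {v : ι → ℤ} (hv : v ≠ 0)
    (hN : l1 v = N) {a b : ι} (hab : a ≠ b) {ε : ℤˣ} (hlt : (v a).natAbs < (v b).natAbs)
    (hle : (v a + ε * v b).natAbs ≤ (v a).natAbs) :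
    𝓕 (shear a b ε v) = x a b ^ (ε : ℤ) • 𝓕 v := by
  set v' := shear a b ε v with hv'
  set u := shear b a ε v with hu
  set u₁ := shear a b ε u with hu₁
  set u₂ := shear b a (-ε : ℤˣ) u₁ with hu₂
  have va' : v' a = v a + ε * v b := shear_apply_self _ _ _ _
  have vb' : v' b = v b := shear_apply_of_ne _ _ _ hab.symm
  have ua : u a = v a := shear_apply_of_ne _ _ _ hab
  have ub : u b = v b + ε * v a := shear_apply_self _ _ _ _
  have ua₁ : u₁ a = u a + ε * u b := shear_apply_self _ _ _ _
  have ub₁ : u₁ b = u b := shear_apply_of_ne _ _ _ hab.symm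
  have ua₂ : u₂ a = u₁ a := shear_apply_of_ne _ _ _ hab
  have ub₂ : u₂ b = u₁ b + (-ε : ℤˣ) * u₁ a := shear_apply_self _ _ _ _
  have hu' : shear b a (-ε : ℤˣ) v' = shear a b ε u₂ := by
    ext e
    by_cases hea : e = a
    · subst hea
      rw [shear_apply_of_ne _ _ _ hab, shear_apply_self, ua₂, ub₂, ub₁, ua₁, ua, ub, va']
      rcases Int.units_eq_one_or ε with rfl | rfl
      · simp; ring
      · simp
    · by_cases heb : e = b
      · subst heb
        rw [shear_apply_of_ne _ _ _ hea, shear_apply_self, ub₂, ub₁, ua₁, ua, ub, va', vb']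
        rcases Int.units_eq_one_or ε with rfl | rfl
        · simp; ring
        · simp
      · simp only [hv', hu₂, hu₁, hu, shear_apply_of_ne _ _ _ hea, shear_apply_of_ne _ _ _ heb]
  have l0 : l1 v' + (v a).natAbs = l1 v + (v a + ε * v b).natAbs := l1_shear a b ε v
  have lu : l1 u + (v b).natAbs = l1 v + (v b + ε * v a).natAbs := l1_shear b a ε v
  have lu₁ : l1 u₁ + (u a).natAbs = l1 u + (u a + ε * u b).natAbs := l1_shear a b ε u
  have lu₂ : l1 u₂ + (u₁ b).natAbs = l1 u₁ + (u₁ b + (-ε : ℤˣ) * u₁ a).natAbs :=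
    l1_shear b a _ u₁
  have hv'0 : v' ≠ 0 := shear_ne_zero hab _ hv
  have hu0 : u ≠ 0 := shear_ne_zero hab.symm _ hv
  have hu₁0 : u₁ ≠ 0 := shear_ne_zero hab _ hu0
  have hu₂0 : u₂ ≠ 0 := shear_ne_zero hab.symm _ hu₁0
  rw [ub₁, ua₁, ua, ub] at lu₂
  rw [ua, ub] at lu₁
  obtain ⟨m1, m2, m3, m4, m5⟩ := natAbs_of_overshoot ε hlt hle
  have hr : Reduces b a ε v := ⟨hab.symm, by omega, m2⟩
  have hr' : Reduces b a (-ε) v' := by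
    refine ⟨hab.symm, ?_, ?_⟩
    · rw [va']; omega
    · rw [va', vb']; exact m5
  have lu'' : l1 (shear b a (-ε : ℤˣ) v') < l1 v' := hr'.l1_lt
  have bounds : l1 v' ≤ N ∧ l1 u < N ∧ l1 u₁ < N ∧ l1 u₂ < N := by
    rw [m4] at lu₂
    clear m4 m5
    generalize (v a + ε * v b).natAbs = n₀ at l0 hle m1
    generalize (v a + ε * (v b + ε * v a)).natAbs = n₁ at lu₁ m3
    generalize (v b + ε * v a).natAbs = n₂ at lu lu₂ m2
    generalize (v a).natAbs = n₃ at *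
    generalize (v b).natAbs = n₄ at *
    omega
  obtain ⟨bv', bu, bu₁, bu₂⟩ := bounds
  have bu' : l1 (shear a b ε u₂) < N := by rw [← hu']; omega
  have f0 : 𝓕 u = x b a ^ (ε : ℤ) • 𝓕 v := euclideanExtension_eq_of_reduces hx hB hf hv hN hr
  have f1 : 𝓕 u₁ = x a b ^ (ε : ℤ) • 𝓕 u := hf _ _ _ _ hu0 hab bu bu₁
  have f2 : 𝓕 u₂ = x b a ^ ((-ε : ℤˣ) : ℤ) • 𝓕 u₁ := hf _ _ _ _ hu₁0 hab.symm bu₁ bu₂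
  have f3 : 𝓕 (shear a b ε u₂) = x a b ^ (ε : ℤ) • 𝓕 u₂ := hf _ _ _ _ hu₂0 hab bu₂ bu'
  -- The last edge is read backwards from v'. If v' itself has norm N, this backward edge is a
  -- Euclidean reduction.
  have f4 : 𝓕 (shear b a (-ε : ℤˣ) v') = x b a ^ ((-ε : ℤˣ) : ℤ) • 𝓕 v' := by
    rcases bv'.lt_or_eq with h | h
    · exact hf _ _ _ _ hv'0 hab.symm h (lu''.trans h)
    · exact euclideanExtension_eq_of_reduces hx hB hf hv'0 h hr'
  rw [hu', f3, f2, f1, f0, Units.val_neg, zpow_neg, eq_inv_smul_iff] at f4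
  rw [← f4]
  simp only [← mul_smul]
  congr 1
  have := hx.braid_units hab ε
  calc _ = x b a ^ (ε : ℤ) * (x a b ^ (ε : ℤ) * (x b a ^ (ε : ℤ))⁻¹ * x a b ^ (ε : ℤ))
      * x b a ^ (ε : ℤ) := by group
    _ = _ := by rw [this]; group

/-- Every new step has an end of norm N, and after inversion it starts there. It then has v_b = 0,
or it is Euclidean, or it is the step rerouted by the braid relation. -/
theorem equivariantBelow_succ (hx : SpecialLinearFamily x) (hB : IsEquivariantOnAxes x B)
    (hf : EquivariantBelow x 𝓕 N) : EquivariantBelow x 𝓕 (N + 1) := by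
  have key : ∀ (v : ι → ℤ) (a b : ι) (ε : ℤˣ), v ≠ 0 → a ≠ b → l1 v = N →
      l1 (shear a b ε v) ≤ N → 𝓕 (shear a b ε v) = x a b ^ (ε : ℤ) • 𝓕 v := by
    intro v a b ε hv hab hN hle
    have h1 := l1_shear a b ε v
    by_cases hb : v b = 0
    · rw [shear_of_eq_zero _ _ hb]
      have h : x a b ∈ MulAction.stabilizer H (𝓕 v) :=
        smul_euclideanExtension_of_eq_zero hx hB hf hv hN hab hb
      exact (zpow_mem h (ε : ℤ)).symm
    by_cases hlt : (v a).natAbs < (v b).natAbs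
    · exact euclideanExtension_shear_of_lt hx hB hf hv hN hab hlt (by omega)
    · refine euclideanExtension_eq_of_reduces hx hB hf hv hN ⟨hab, hb, ?_⟩
      rcases Int.units_eq_one_or ε with rfl | rfl <;>
        simp only [Units.val_neg, Units.val_one, neg_mul, one_mul] at * <;> omega
  intro v a b ε hv hab h1 h2
  by_cases h3 : l1 v = N
  · exact key v a b ε hv hab h3 (by omega)
  by_cases h4 : l1 (shear a b ε v) = N
  · have h := key _ a b (-ε) (shear_ne_zero hab ε hv) hab h4
      (by rw [Units.val_neg, shear_neg_shear hab]; omega)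
    rw [Units.val_neg, shear_neg_shear hab, zpow_neg, eq_inv_smul_iff] at h
    exact h.symm
  · exact hf v a b ε hv hab (by omega) (by omega)

theorem euclideanExtension_shear (hx : SpecialLinearFamily x) (hB : IsEquivariantOnAxes x B)
    {v : ι → ℤ} (hv : v ≠ 0) {a b : ι} (hab : a ≠ b) (ε : ℤˣ) :
    𝓕 (shear a b ε v) = x a b ^ (ε : ℤ) • 𝓕 v := by
  have h (N : ℕ) : EquivariantBelow x 𝓕 N := by
    induction N with
    | zero => intro v a b ε _ _ h; omega
    | succ N ih => exact equivariantBelow_succ hx hB ih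
  exact h (l1 v + l1 (shear a b ε v) + 1) v a b ε hv hab (by omega) (by omega)

end Extension

/-! ### Cosets of the stabilizer of a basis vector. -/

section Stabilizer

variable {ι H : Type*} [Group H]

/-- The subgroup generated by the `x_{ab}` that fix the basis vector `e_β`. -/
def columnStabilizer (x : ι → ι → H) (β : ι) : Subgroup H :=
  Subgroup.closure {g | ∃ a b, a ≠ b ∧ b ≠ β ∧ g = x a b}

variable {x : ι → ι → H} {β : ι}

theorem mem_columnStabilizer {a b : ι} (hab : a ≠ b) (hb : b ≠ β) :
    x a b ∈ columnStabilizer x β :=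
  Subgroup.subset_closure ⟨a, b, hab, hb, rfl⟩

theorem weyl_mem_columnStabilizer {a b : ι} (hab : a ≠ b) (ha : a ≠ β) (hb : b ≠ β) :
    weyl x a b ∈ columnStabilizer x β :=
  mul_mem (mul_mem (mem_columnStabilizer hab hb) (inv_mem (mem_columnStabilizer hab.symm ha)))
    (mem_columnStabilizer hab hb)

theorem SpecialLinearFamily.exists_inv_weyl_conj [DecidableEq ι] (hx : SpecialLinearFamily x)
    {a b p q : ι} (hab : a ≠ b) (hpq : p ≠ q) : ∃ s : ℤ, (weyl x a b)⁻¹ * x p q * weyl x a b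
      = x (Equiv.swap a b p) (Equiv.swap a b q) ^ s := by
  obtain ⟨s, hs⟩ := hx.exists_weyl_conj hab.symm hpq
  rw [hx.weyl_symm a b hab, inv_inv, Equiv.swap_comm] at hs
  exact ⟨s, hs⟩

/-- Two transpositions cancel, so w² acts like a diagonal sign matrix and conjugates each root
element to a power of itself. -/
theorem SpecialLinearFamily.weyl_sq_conj_mem (hx : SpecialLinearFamily x) {c : ι} (hc : c ≠ β)
    {g : H} (hg : g ∈ columnStabilizer x β) :
    (weyl x c β ^ 2)⁻¹ * g * weyl x c β ^ 2 ∈ columnStabilizer x β := by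
  classical
  have h : columnStabilizer x β
      ≤ (columnStabilizer x β).comap (MulAut.conj (weyl x c β ^ 2)⁻¹).toMonoidHom := by
    rw [columnStabilizer, Subgroup.closure_le]
    rintro _ ⟨p, q, hpq, hq, rfl⟩
    obtain ⟨s, hs⟩ := hx.exists_inv_weyl_conj hc hpq
    obtain ⟨t, ht⟩ := hx.exists_inv_weyl_conj hc ((Equiv.swap c β).injective.ne hpq)
    rw [Equiv.swap_apply_self, Equiv.swap_apply_self] at ht
    have e : (weyl x c β ^ 2)⁻¹ * x p q * weyl x c β ^ 2 = (x p q ^ t) ^ s := by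
      have := conj_zpow (i := s) (a := (weyl x c β)⁻¹)
        (b := x (Equiv.swap c β p) (Equiv.swap c β q))
      rw [inv_inv] at this
      rw [← ht, this, ← hs, pow_two]; group
    change MulAut.conj (weyl x c β ^ 2)⁻¹ (x p q) ∈ columnStabilizer x β
    rw [MulAut.conj_apply, inv_inv, e]
    exact zpow_mem (zpow_mem (mem_columnStabilizer hpq hq) _) _
  have : MulAut.conj (weyl x c β ^ 2)⁻¹ g ∈ columnStabilizer x β := h hg
  rwa [MulAut.conj_apply, inv_inv] at this

local notation "⟦" g "⟧ₚ" => (QuotientGroup.mk g : H ⧸ columnStabilizer x β)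

/-- Makes the coset assigned to −e_β independent of the auxiliary index. -/
theorem SpecialLinearFamily.weyl_sq_eq (hx : SpecialLinearFamily x) {a b : ι} (ha : a ≠ β)
    (hb : b ≠ β) : ⟦weyl x a β ^ 2⟧ₚ = ⟦weyl x b β ^ 2⟧ₚ := by
  by_cases hab : a = b
  · rw [hab]
  have h1 : weyl x a b * weyl x b β ^ 2 * (weyl x a b)⁻¹ = weyl x a β ^ 2 := by
    rw [← conj_pow, hx.weyl_conj_weyl hab ha hb]
  have hm := weyl_mem_columnStabilizer (x := x) hab ha hb
  have h2 : (weyl x a β ^ 2)⁻¹ * weyl x b β ^ 2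
      = weyl x a b * ((weyl x b β ^ 2)⁻¹ * (weyl x a b)⁻¹ * weyl x b β ^ 2) := by
    rw [← h1]; group
  rw [QuotientGroup.eq, h2]
  exact mul_mem hm (hx.weyl_sq_conj_mem hb (inv_mem hm))

/-- This is where w⁴ = 1 enters the presentation argument: −e_β is reached from e_β by w² as well as
by w⁻², and both must give the same coset. -/
theorem SpecialLinearFamily.inv_weyl_sq (hx : SpecialLinearFamily x) {a b : ι} (hab : a ≠ b) :
    (weyl x a b)⁻¹ * (weyl x a b)⁻¹ = weyl x a b ^ 2 := by
  rw [← mul_inv_rev, inv_eq_iff_mul_eq_one, ← hx.weyl_pow_four a b hab]; group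

open Classical in
/-- The coset attached to `m e_a`. -/
noncomputable def axisCoset (x : ι → ι → H) (β a : ι) (m : ℤ) : H ⧸ columnStabilizer x β :=
  if a = β then
    if 0 < m then QuotientGroup.mk 1
    else if h : ∃ c, c ≠ β then QuotientGroup.mk (weyl x h.choose β ^ 2) else QuotientGroup.mk 1
  else if 0 < m then QuotientGroup.mk (weyl x a β) else QuotientGroup.mk (weyl x a β)⁻¹

theorem axisCoset_self_pos {m : ℤ} (hm : 0 < m) : axisCoset x β β m = ⟦1⟧ₚ := by
  simp [axisCoset, hm]

theorem axisCoset_self_neg (hx : SpecialLinearFamily x) {m : ℤ} (hm : m < 0) {c : ι}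
    (hc : c ≠ β) : axisCoset x β β m = ⟦weyl x c β ^ 2⟧ₚ := by
  have h : ∃ c, c ≠ β := ⟨c, hc⟩
  rw [axisCoset, if_pos rfl, if_neg (by omega), dif_pos h]
  exact hx.weyl_sq_eq h.choose_spec hc

theorem axisCoset_pos {a : ι} (ha : a ≠ β) {m : ℤ} (hm : 0 < m) :
    axisCoset x β a m = ⟦weyl x a β⟧ₚ := by
  rw [axisCoset, if_neg ha, if_pos hm]

theorem axisCoset_neg {a : ι} (ha : a ≠ β) {m : ℤ} (hm : m < 0) :
    axisCoset x β a m = ⟦(weyl x a β)⁻¹⟧ₚ := by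
  rw [axisCoset, if_neg ha, if_neg (by omega)]

theorem mk_eq_of_conj_eq {g k l : H} (h : g * k * g⁻¹ = l) (hg : g ∈ columnStabilizer x β) :
    ⟦g * k⟧ₚ = ⟦l⟧ₚ := by
  rw [QuotientGroup.eq, ← h]
  have : (g * k)⁻¹ * (g * k * g⁻¹) = g⁻¹ := by group
  rw [this]
  exact inv_mem hg

theorem conj_inv_eq {g k l : H} (h : g * k * g⁻¹ = l) : g * k⁻¹ * g⁻¹ = l⁻¹ := by
  rw [← h]; group

/-- Only the sign of m matters: e_β, −e_β, e_a and −e_a carry the cosets of 1, w_{cβ}², w_{aβ} and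
w_{aβ}⁻¹. If neither index is β, then w_{ab} itself lies in the stabilizer and the conjugation
formula applies. -/
theorem weyl_smul_axisCoset (hx : SpecialLinearFamily x) {a b : ι} {m : ℤ} (hab : a ≠ b)
    (hm : m ≠ 0) : weyl x a b • axisCoset x β b m = axisCoset x β a m := by
  rcases hm.lt_or_gt with hm | hm
  · by_cases hb : b = β
    · subst hb
      rw [axisCoset_self_neg hx hm hab, axisCoset_neg hab hm, MulAction.Quotient.smul_mk,
        smul_eq_mul, ← hx.inv_weyl_sq hab, mul_inv_cancel_left]
    by_cases ha : a = β
    · subst ha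
      rw [axisCoset_self_neg hx hm hb, axisCoset_neg hb hm, MulAction.Quotient.smul_mk,
        smul_eq_mul, hx.weyl_symm b a hb, hx.inv_weyl_sq hb]
    · rw [axisCoset_neg hb hm, axisCoset_neg ha hm, MulAction.Quotient.smul_mk, smul_eq_mul]
      exact mk_eq_of_conj_eq (conj_inv_eq (hx.weyl_conj_weyl hab ha hb))
        (weyl_mem_columnStabilizer hab ha hb)
  · by_cases hb : b = β
    · subst hb
      rw [axisCoset_self_pos hm, axisCoset_pos hab hm, MulAction.Quotient.smul_mk, smul_eq_mul,
        mul_one]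
    by_cases ha : a = β
    · subst ha
      rw [axisCoset_self_pos hm, axisCoset_pos hb hm, MulAction.Quotient.smul_mk,
        smul_eq_mul, hx.weyl_symm b a hb, inv_mul_cancel]
    · rw [axisCoset_pos hb hm, axisCoset_pos ha hm, MulAction.Quotient.smul_mk, smul_eq_mul]
      exact mk_eq_of_conj_eq (hx.weyl_conj_weyl hab ha hb) (weyl_mem_columnStabilizer hab ha hb)

theorem weyl_smul_axisCoset_neg (hx : SpecialLinearFamily x) {a b : ι} {m : ℤ} (hab : a ≠ b)
    (hm : m ≠ 0) : weyl x a b • axisCoset x β a m = axisCoset x β b (-m) := by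
  rcases hm.lt_or_gt with hm | hm
  · have hm' : 0 < -m := by omega
    by_cases hb : b = β
    · subst hb
      rw [axisCoset_self_pos hm', axisCoset_neg hab hm, MulAction.Quotient.smul_mk,
        smul_eq_mul, mul_inv_cancel]
    by_cases ha : a = β
    · subst ha
      rw [axisCoset_self_neg hx hm hb, axisCoset_pos hb hm', MulAction.Quotient.smul_mk,
        smul_eq_mul, hx.weyl_symm b a hb, pow_two, inv_mul_cancel_left]
    · rw [axisCoset_neg ha hm, axisCoset_pos hb hm', MulAction.Quotient.smul_mk, smul_eq_mul]
      refine mk_eq_of_conj_eq ?_ (weyl_mem_columnStabilizer hab ha hb)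
      rw [conj_inv_eq (hx.weyl_conj_weyl_neg hab ha hb), inv_inv]
  · have hm' : -m < 0 := by omega
    by_cases hb : b = β
    · subst hb
      rw [axisCoset_self_neg hx hm' hab, axisCoset_pos hab hm, MulAction.Quotient.smul_mk,
        smul_eq_mul, pow_two]
    by_cases ha : a = β
    · subst ha
      rw [axisCoset_self_pos hm, axisCoset_neg hb hm', MulAction.Quotient.smul_mk,
        smul_eq_mul, hx.weyl_symm b a hb, mul_one]
    · rw [axisCoset_pos ha hm, axisCoset_neg hb hm', MulAction.Quotient.smul_mk, smul_eq_mul]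
      exact mk_eq_of_conj_eq (hx.weyl_conj_weyl_neg hab ha hb)
        (weyl_mem_columnStabilizer hab ha hb)

theorem smul_mk_eq_self {g k : H} (h : k⁻¹ * g * k ∈ columnStabilizer x β) : g • ⟦k⟧ₚ = ⟦k⟧ₚ := by
  rw [MulAction.Quotient.smul_mk, smul_eq_mul, eq_comm, QuotientGroup.eq, ← mul_assoc]
  exact h

/-- Conjugation by the coset representative of ±e_c exchanges c and β up to sign. Since b ≠ c, the
new column index differs from β, so the conjugate lies in the stabilizer. -/
theorem smul_axisCoset (hx : SpecialLinearFamily x) {a b c : ι} {m : ℤ} (hab : a ≠ b)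
    (hcb : c ≠ b) (hm : m ≠ 0) : x a b • axisCoset x β c m = axisCoset x β c m := by
  classical
  have hmem {p q : ι} (hpq : p ≠ q) (hq : q ≠ β) (s : ℤ) : x p q ^ s ∈ columnStabilizer x β :=
    zpow_mem (mem_columnStabilizer hpq hq) s
  by_cases hc : c = β
  · subst hc
    rcases hm.lt_or_gt with hm | hm
    · rw [axisCoset_self_neg hx hm hcb.symm]
      exact smul_mk_eq_self (hx.weyl_sq_conj_mem hcb.symm (mem_columnStabilizer hab hcb.symm))
    · rw [axisCoset_self_pos hm]
      refine smul_mk_eq_self ?_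
      simpa using mem_columnStabilizer (x := x) hab hcb.symm
  · have hb' : Equiv.swap c β b ≠ β := by
      have := (Equiv.swap c β).injective.ne hcb.symm
      rwa [Equiv.swap_apply_left] at this
    have hab' := (Equiv.swap c β).injective.ne hab
    rcases hm.lt_or_gt with hm | hm
    · rw [axisCoset_neg hc hm]
      refine smul_mk_eq_self ?_
      obtain ⟨s, hs⟩ := hx.exists_weyl_conj hc hab
      rw [inv_inv, hs]
      exact hmem hab' hb' s
    · rw [axisCoset_pos hc hm]
      refine smul_mk_eq_self ?_
      obtain ⟨s, hs⟩ := hx.exists_inv_weyl_conj hc hab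
      rw [hs]
      exact hmem hab' hb' s

open Classical in
/-- The coset attached to a vector on a coordinate axis. -/
noncomputable def axisFunction (x : ι → ι → H) (β : ι) (v : ι → ℤ) : H ⧸ columnStabilizer x β :=
  if h : ∃ a, v a ≠ 0 then axisCoset x β h.choose (v h.choose) else QuotientGroup.mk 1

theorem axisFunction_single [DecidableEq ι] (a : ι) {m : ℤ} (hm : m ≠ 0) :
    axisFunction x β (Pi.single a m) = axisCoset x β a m := by
  have h : ∃ c, (Pi.single a m : ι → ℤ) c ≠ 0 := ⟨a, by simpa using hm⟩
  rw [axisFunction, dif_pos h]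
  have : h.choose = a := by
    by_contra hne
    exact h.choose_spec (Pi.single_eq_of_ne hne _)
  rw [this, Pi.single_eq_same]

theorem isEquivariantOnAxes_axisFunction [DecidableEq ι] (hx : SpecialLinearFamily x) :
    IsEquivariantOnAxes x (axisFunction x β) where
  weyl_smul a b m hab hm := by
    rw [axisFunction_single _ hm, axisFunction_single _ hm, weyl_smul_axisCoset hx hab hm]
  weyl_smul_neg a b m hab hm := by
    rw [axisFunction_single _ hm, axisFunction_single _ (neg_ne_zero.2 hm),
      weyl_smul_axisCoset_neg hx hab hm]
  smul a b c m hab hcb hm := by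
    rw [axisFunction_single _ hm, smul_axisCoset hx hab hcb hm]

/-- An element of the group generated by the `x_{ab}` whose action on `ℤ^ι` fixes `e_β` lies in
the group generated by the `x_{ab}` that fix `e_β`. -/
theorem mem_columnStabilizer_of_column_eq [DecidableEq ι] [Fintype ι]
    (hx : SpecialLinearFamily x) {col : H → ι → ℤ} (hone : col 1 = Pi.single β 1)
    (hmul : ∀ a b, a ≠ b → ∀ (ε : ℤˣ) h, col (x a b ^ (ε : ℤ) * h) = shear a b ε (col h))
    {h : H} (hh : h ∈ Subgroup.closure {g | ∃ a b, a ≠ b ∧ g = x a b})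
    (hcol : col h = Pi.single β 1) : h ∈ columnStabilizer x β := by
  have hB := isEquivariantOnAxes_axisFunction (β := β) hx
  have hstep (a b : ι) (hab : a ≠ b) (ε : ℤˣ) (y : H) (hy : col y ≠ 0 ∧
      euclideanExtension x (axisFunction x β) (col y) = ⟦y⟧ₚ) :
      col (x a b ^ (ε : ℤ) * y) ≠ 0 ∧
        euclideanExtension x (axisFunction x β) (col (x a b ^ (ε : ℤ) * y))
          = ⟦x a b ^ (ε : ℤ) * y⟧ₚ := by
    rw [hmul a b hab]
    refine ⟨shear_ne_zero hab _ hy.1, ?_⟩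
    rw [euclideanExtension_shear hx hB hy.1 hab, hy.2, MulAction.Quotient.smul_mk, smul_eq_mul]
  -- By equivariance along each letter of a word for h, the extension sends the column of h to the
  -- coset of h. At e_β it gives the trivial coset.
  have key : col h ≠ 0 ∧ euclideanExtension x (axisFunction x β) (col h) = ⟦h⟧ₚ := by
    clear hcol
    induction hh using Subgroup.closure_induction_left with
    | one =>
      refine ⟨by simp [hone], ?_⟩
      rw [hone, euclideanExtension_single, axisFunction_single _ one_ne_zero,
        axisCoset_self_pos one_pos]
    | mul_left g hg y _ ih =>
      obtain ⟨a, b, hab, rfl⟩ := hg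
      simpa using hstep a b hab 1 y ih
    | inv_mul_cancel g hg y _ ih =>
      obtain ⟨a, b, hab, rfl⟩ := hg
      simpa using hstep a b hab (-1) y ih
  rw [hcol, euclideanExtension_single, axisFunction_single _ one_ne_zero,
    axisCoset_self_pos one_pos, QuotientGroup.eq, inv_one, one_mul] at key
  exact key.2

end Stabilizer

/-! ### Faithfulness by induction on the index set. -/

section Faithful

variable {I H : Type*} [Group H] {x : I → I → H}

/-- The group generated by the `x_{ab}` with `a ∈ J` and `b ∈ K`. -/
def blockSubgroup (x : I → I → H) (J K : Set I) : Subgroup H :=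
  Subgroup.closure {g | ∃ a ∈ J, ∃ b ∈ K, a ≠ b ∧ g = x a b}

theorem mem_blockSubgroup {J K : Set I} {a b : I} (ha : a ∈ J) (hb : b ∈ K) (hab : a ≠ b) :
    x a b ∈ blockSubgroup x J K :=
  Subgroup.subset_closure ⟨a, ha, b, hb, hab, rfl⟩

theorem blockSubgroup_mono {J J' K K' : Set I} (hJ : J ⊆ J') (hK : K ⊆ K') :
    blockSubgroup x J K ≤ blockSubgroup x J' K' :=
  Subgroup.closure_mono fun _ ⟨a, ha, b, hb, hab, e⟩ => ⟨a, hJ ha, b, hK hb, hab, e⟩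

/-- Induction on the word length in a subgroup `blockSubgroup x J K`. -/
theorem blockSubgroup_induction {J K : Set I} {p : H → Prop} (one : p 1)
    (step : ∀ a ∈ J, ∀ b ∈ K, a ≠ b → ∀ (ε : ℤˣ) y, p y → p (x a b ^ (ε : ℤ) * y)) {h : H}
    (hh : h ∈ blockSubgroup x J K) : p h := by
  induction hh using Subgroup.closure_induction_left with
  | one => exact one
  | mul_left g hg y _ ih =>
    obtain ⟨a, ha, b, hb, hab, rfl⟩ := hg
    simpa using step a ha b hb hab 1 y ih
  | inv_mul_cancel g hg y _ ih =>
    obtain ⟨a, ha, b, hb, hab, rfl⟩ := hg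
    simpa using step a ha b hb hab (-1) y ih

/-- The x_{βb} with fixed β commute with each other, so all powers of x_{βd} can be collected on the
left. -/
theorem exists_eq_zpow_mul_of_mem_insert (hx : SteinbergFamily x) {β d : I} {K : Set I}
    (hd : d ≠ β) {u : H} (hu : u ∈ blockSubgroup x {β} (insert d K)) :
    ∃ n : ℤ, ∃ u' ∈ blockSubgroup x {β} K, u = x β d ^ n * u' := by
  refine blockSubgroup_induction
    (p := fun u => ∃ n : ℤ, ∃ u' ∈ blockSubgroup x {β} K, u = x β d ^ n * u')
    ⟨0, 1, one_mem _, by simp⟩ ?_ hu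
  rintro a rfl b hb hab ε y ⟨n, u', hu', rfl⟩
  rcases hb with rfl | hb
  · exact ⟨ε + n, u', hu', by rw [zpow_add, mul_assoc]⟩
  · refine ⟨n, x a b ^ (ε : ℤ) * u',
      mul_mem (zpow_mem (mem_blockSubgroup (Set.mem_singleton _) hb hab) _) hu', ?_⟩
    rw [← mul_assoc, ← mul_assoc,
      ((hx.comm a b a d hab hd.symm hab.symm hd.symm).zpow_zpow (ε : ℤ) n).eq]

variable [DecidableEq I]

/-- A description of the columns of the matrices by which a group acts on `ℤ^I`, where the `x_{ab}`
act as elementary matrices. -/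
structure IsColumnMap (x : I → I → H) (col : H → I → I → ℤ) : Prop where
  one : ∀ b, col 1 b = Pi.single b 1
  mul : ∀ a b, a ≠ b → ∀ h c, col (x a b * h) c = shear a b 1 (col h c)

variable {col : H → I → I → ℤ}

theorem IsColumnMap.inv_mul (hc : IsColumnMap x col) {a b : I} (hab : a ≠ b) (h : H) (c : I) :
    col ((x a b)⁻¹ * h) c = shear a b (-1) (col h c) := by
  have := hc.mul a b hab ((x a b)⁻¹ * h) c
  rw [mul_inv_cancel_left] at this
  rw [this, shear_neg_shear hab]

theorem IsColumnMap.units_mul (hc : IsColumnMap x col) {a b : I} (hab : a ≠ b) (ε : ℤˣ) (h : H)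
    (c : I) : col (x a b ^ (ε : ℤ) * h) c = shear a b ε (col h c) := by
  rcases Int.units_eq_one_or ε with rfl | rfl
  · simpa using hc.mul a b hab h c
  · simpa using hc.inv_mul hab h c

theorem IsColumnMap.apply_of_notMem (hc : IsColumnMap x col) {J K : Set I} {u : H}
    (hu : u ∈ blockSubgroup x J K) {i : I} (hi : i ∉ J) (h : H) (c : I) :
    col (u * h) c i = col h c i := by
  refine blockSubgroup_induction (p := fun u => col (u * h) c i = col h c i) (by simp) ?_ hu
  intro a ha b _ hab ε y hy
  rw [mul_assoc, hc.units_mul hab, shear_apply_of_ne _ _ _ (by rintro rfl; exact hi ha), hy]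

theorem IsColumnMap.column_of_notMem (hc : IsColumnMap x col) {J K : Set I} {u : H}
    (hu : u ∈ blockSubgroup x J K) {d : I} (hd : d ∉ K) :
    col u d = Pi.single d 1 := by
  refine blockSubgroup_induction (p := fun u => col u d = Pi.single d 1) (hc.one d) ?_ hu
  intro a _ b hb hab ε y hy
  rw [hc.units_mul hab, hy, shear_of_eq_zero]
  rw [Pi.single_eq_of_ne]
  rintro rfl
  exact hd hb

/-- The row subgroup acts faithfully. -/
theorem eq_one_of_mem_row (hx : SteinbergFamily x) (hc : IsColumnMap x col) {β : I}
    (K : Finset I) (hβ : β ∉ K) {u : H} (hu : u ∈ blockSubgroup x {β} K)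
    (hcol : ∀ b ∈ K, col u b β = 0) : u = 1 := by
  induction K using Finset.induction_on generalizing u with
  | empty =>
    refine blockSubgroup_induction (p := fun u => u = 1) (Eq.refl (1 : H)) ?_ hu
    intro a _ b hb
    simp at hb
  | insert d K hdK ih =>
    simp only [Finset.mem_insert, not_or] at hβ
    rw [Finset.coe_insert] at hu
    obtain ⟨n, u', hu', rfl⟩ :=
      exists_eq_zpow_mul_of_mem_insert hx (Ne.symm hβ.1) hu
    have hn (n : ℤ) (h : H) (c : I) : col (x β d ^ n * h) c = shear β d n (col h c) := by
      induction n using Int.induction_on with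
      | zero => simp [shear]
      | succ k ih =>
        rw [add_comm, zpow_add, zpow_one, mul_assoc, hc.mul _ _ hβ.1, ih]
        ext e
        simp only [shear, Function.update_apply]
        grind
      | pred k ih =>
        rw [sub_eq_neg_add, zpow_add, zpow_neg_one, mul_assoc, hc.inv_mul hβ.1, ih]
        ext e
        simp only [shear, Function.update_apply]
        grind
    have hd := hcol d (Finset.mem_insert_self _ _)
    rw [hn, hc.column_of_notMem hu' (by simpa using hdK), shear_apply_self,
      Pi.single_eq_same, Pi.single_eq_of_ne hβ.1] at hd
    have hn0 : n = 0 := by simpa using hd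
    subst hn0
    rw [zpow_zero, one_mul] at hcol ⊢
    exact ih hβ.2 hu' fun b hb => hcol b (Finset.mem_insert_of_mem hb)

theorem conj_mem_row (hx : SteinbergFamily x) {β : I} {K : Set I} (hβ : β ∉ K) {a b : I}
    (ha : a ∈ K) (hb : b ∈ K) (hab : a ≠ b) (n : ℤ) {u : H} (hu : u ∈ blockSubgroup x {β} K) :
    x a b ^ n * u * (x a b ^ n)⁻¹ ∈ blockSubgroup x {β} K := by
  have h : blockSubgroup x {β} K
      ≤ (blockSubgroup x {β} K).comap (MulAut.conj (x a b ^ n)).toMonoidHom := by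
    rw [blockSubgroup, Subgroup.closure_le]
    rintro _ ⟨p, rfl, c, hc, hpc, rfl⟩
    change MulAut.conj (x a b ^ n) (x p c) ∈ blockSubgroup x {p} K
    rw [MulAut.conj_apply]
    have hpa : p ≠ a := fun e => hβ (e ▸ ha)
    have hpb : p ≠ b := fun e => hβ (e ▸ hb)
    by_cases hca : c = a
    · subst hca
      have h1 := hx.zpow_mul_zpow hpc hab hpb 1 n
      rw [zpow_one, one_mul] at h1
      have h2 : x c b ^ n * x p c * (x c b ^ n)⁻¹ = (x p b ^ n)⁻¹ * x p c := by
        rw [mul_inv_eq_iff_eq_mul, mul_assoc, h1]; group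
      rw [h2]
      exact mul_mem (inv_mem (zpow_mem (mem_blockSubgroup (Set.mem_singleton _) hb hpb) _))
        (mem_blockSubgroup (Set.mem_singleton _) hc hpc)
    · rw [((hx.comm a b p c hab hpc hpb.symm (Ne.symm hca)).zpow_left n).eq, mul_inv_cancel_right]
      exact mem_blockSubgroup (Set.mem_singleton _) hc hpc
  exact h hu

/-- The parabolic decomposition: the row group at β is normalized by the group on K, hence each word
separates into the two parts. -/
theorem exists_eq_mul_of_mem_insert (hx : SteinbergFamily x) {β : I} {K : Set I} (hβ : β ∉ K)
    {h : H} (hh : h ∈ blockSubgroup x (insert β K) K) :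
    ∃ u ∈ blockSubgroup x {β} K, ∃ h' ∈ blockSubgroup x K K, h = u * h' := by
  refine blockSubgroup_induction
    (p := fun h => ∃ u ∈ blockSubgroup x {β} K, ∃ h' ∈ blockSubgroup x K K, h = u * h')
    ⟨1, one_mem _, 1, one_mem _, by simp⟩ ?_ hh
  rintro a ha b hb hab ε y ⟨u, hu, h', hh', rfl⟩
  rcases ha with rfl | ha
  · exact ⟨_, mul_mem (zpow_mem (mem_blockSubgroup (Set.mem_singleton _) hb hab) _) hu, h', hh',
      (mul_assoc _ _ _).symm⟩
  · exact ⟨_, conj_mem_row hx hβ ha hb hab ε hu, x a b ^ (ε : ℤ) * h',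
      mul_mem (zpow_mem (mem_blockSubgroup ha hb hab) _) hh', by group⟩

/-- The stabilizer theorem needs a finite index type, so family and columns are restricted to K ∪
{β} and the result is carried back. -/
theorem mem_blockSubgroup_of_column_eq (hx : SpecialLinearFamily x) (hc : IsColumnMap x col)
    {β : I} {K : Finset I} {h : H}
    (hh : h ∈ blockSubgroup x (insert β K : Set I) (insert β K))
    (hcol : col h β = Pi.single β 1) : h ∈ blockSubgroup x (insert β K : Set I) K := by
  set L := insert β K with hL
  have hmemL (i : I) : i ∈ L ↔ i ∈ (insert β K : Set I) := by simp [hL]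
  let β' : L := ⟨β, Finset.mem_insert_self _ _⟩
  have hx' := hx.comp (Subtype.val : L → I) Subtype.val_injective
  have hres (v : I → ℤ) (a b : L) (n : ℤ) :
      (fun i : L => shear a.1 b.1 n v i) = shear a b n fun i : L => v i := by
    ext i
    by_cases hi : i = a
    · subst hi
      rw [shear_apply_self, shear_apply_self]
    · rw [shear_apply_of_ne _ _ _ hi, shear_apply_of_ne _ _ _ (Subtype.val_injective.ne hi)]
  have hsingle : (fun i : L => (Pi.single β 1 : I → ℤ) i) = Pi.single β' 1 := by
    ext i
    by_cases hi : i = β'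
    · subst hi; simp [β']
    · rw [Pi.single_eq_of_ne hi, Pi.single_eq_of_ne (fun e => hi (Subtype.ext e))]
  have key := mem_columnStabilizer_of_column_eq (β := β') hx'
    (col := fun h i => col h β i) (h := h) (by rw [hc.one]; exact hsingle)
    (fun a b hab ε y => by
      rw [hc.units_mul (Subtype.val_injective.ne hab)]
      exact hres _ a b _)
    ((Subgroup.closure_mono (by
      rintro _ ⟨a, ha, b, hb, hab, rfl⟩
      exact ⟨⟨a, (hmemL a).2 ha⟩, ⟨b, (hmemL b).2 hb⟩, fun e => hab (congrArg Subtype.val e), rfl⟩))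
      hh)
    (by rw [hcol]; exact hsingle)
  refine (Subgroup.closure_mono ?_) key
  rintro _ ⟨a, b, hab, hb, rfl⟩
  refine ⟨a, (hmemL a).1 a.2, b, ?_, Subtype.val_injective.ne hab, rfl⟩
  exact (Finset.mem_insert.1 b.2).resolve_left fun e => hb (Subtype.ext e)

theorem eq_one_of_columns_eq_of_finset (hx : SpecialLinearFamily x) (hc : IsColumnMap x col)
    (K : Finset I) {h : H} (hh : h ∈ blockSubgroup x (K : Set I) K)
    (hcol : ∀ b ∈ K, col h b = Pi.single b 1) : h = 1 := by
  induction K using Finset.induction_on generalizing h with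
  | empty =>
    refine blockSubgroup_induction (p := fun u => u = 1) (Eq.refl (1 : H)) ?_ hh
    intro a ha
    simp at ha
  | insert β K hβ ih =>
    have hxs := hx.toSteinbergFamily
    rw [Finset.coe_insert] at hh
    have hβ' : β ∉ (K : Set I) := by simpa using hβ
    have h1 := mem_blockSubgroup_of_column_eq hx hc hh (hcol β (Finset.mem_insert_self _ _))
    obtain ⟨u, hu, h', hh', rfl⟩ := exists_eq_mul_of_mem_insert hxs hβ' h1
    -- Left multiplication by u changes only row β, so the other rows of h' agree with those of h.
    -- Row β of h' is that of the identity, because h' only involves indices in K.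
    have h2 : h' = 1 := by
      refine ih hh' fun b hb => funext fun i => ?_
      by_cases hi : i = β
      · subst hi
        have := hc.apply_of_notMem hh' hβ' 1 b
        rw [mul_one, hc.one] at this
        exact this
      · rw [← hc.apply_of_notMem hu hi, hcol b (Finset.mem_insert_of_mem hb)]
    subst h2
    rw [mul_one] at hcol ⊢
    refine eq_one_of_mem_row hxs hc K hβ hu fun b hb => ?_
    rw [hcol b (Finset.mem_insert_of_mem hb), Pi.single_eq_of_ne]
    rintro rfl
    exact hβ hb

/-- The group generated by a family that satisfies the Steinberg relations over `ℤ` and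
`w_{ab}⁴ = 1` acts faithfully on `ℤ^I`. -/
theorem SpecialLinearFamily.eq_one_of_columns_eq (hx : SpecialLinearFamily x)
    (hc : IsColumnMap x col) {h : H} (hh : h ∈ Subgroup.closure {g | ∃ a b, a ≠ b ∧ g = x a b})
    (hcol : ∀ b, col h b = Pi.single b 1) : h = 1 := by
  have hfin : ∃ K : Finset I, h ∈ blockSubgroup x (K : Set I) K := by
    clear hcol
    induction hh using Subgroup.closure_induction with
    | mem g hg =>
      obtain ⟨a, b, hab, rfl⟩ := hg
      exact ⟨{a, b}, mem_blockSubgroup (by simp) (by simp) hab⟩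
    | one => exact ⟨∅, one_mem _⟩
    | mul g k _ _ ihg ihk =>
      obtain ⟨K, hK⟩ := ihg
      obtain ⟨L, hL⟩ := ihk
      refine ⟨K ∪ L, mul_mem (blockSubgroup_mono ?_ ?_ hK) (blockSubgroup_mono ?_ ?_ hL)⟩ <;> simp
    | inv g _ ih =>
      obtain ⟨K, hK⟩ := ih
      exact ⟨K, inv_mem hK⟩
  obtain ⟨K, hK⟩ := hfin
  exact eq_one_of_columns_eq_of_finset hx hc K hK fun b _ => hcol b

end Faithful

/-! ### From pairs in different blocks to all pairs. -/

section BlockFamily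

/-- A family `y a b`, meaningful for indices `a`, `b` in different blocks, that satisfies the
Steinberg relations between its members. -/
structure BlockSteinbergFamily {I H : Type*} [Group H] (k : I → Fin 4) (y : I → I → H) : Prop where
  mul : ∀ a b c, k a ≠ k b → k b ≠ k c → k a ≠ k c → ⁅y a b, y b c⁆ = y a c
  comm : ∀ a b c d, k a ≠ k b → k c ≠ k d → b ≠ c → a ≠ d → Commute (y a b) (y c d)

/-- Four blocks always leave one free beside three given ones; the auxiliary indices below are taken
from it. -/
theorem Fin.exists_ne_three (i j l : Fin 4) : ∃ m, m ≠ i ∧ m ≠ j ∧ m ≠ l := by decide +revert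

variable {I H : Type*} [Group H] {k : I → Fin 4} {y : I → I → H}

/-- The extension of a family on pairs of indices in different blocks to all pairs; `c` chooses an
index in each block. -/
def blockExtension (k : I → Fin 4) (c : Fin 4 → I) (y : I → I → H) (a b : I) : H :=
  if k a ≠ k b then y a b else ⁅y a (c (k a + 1)), y (c (k a + 1)) b⁆

variable {c : Fin 4 → I}

theorem blockExtension_of_ne {a b : I} (h : k a ≠ k b) : blockExtension k c y a b = y a b :=
  if_pos h

namespace BlockSteinbergFamily

/-- Expand y_{db} as [y_{de}, y_{eb}] and conjugate by y_{ad}: this trades the intermediate index d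
for e. -/
theorem commutatorElement_eq_of_ne (hy : BlockSteinbergFamily k y) {a b d e : I} (hab : a ≠ b)
    (hk : k a = k b) (hd : k d ≠ k a) (he : k e ≠ k a) (hde : k d ≠ k e) :
    ⁅y a d, y d b⁆ = ⁅y a e, y e b⁆ := by
  have hde' : d ≠ e := fun h => hde (h ▸ rfl)
  have hdb : k d ≠ k b := hk ▸ hd
  have heb : k e ≠ k b := hk ▸ he
  have hbe : b ≠ e := fun h => heb (h ▸ rfl)
  have hbd : b ≠ d := fun h => hdb (h ▸ rfl)
  have h1 : Commute (y a e) (y d b) := hy.comm _ _ _ _ he.symm hdb hde'.symm hab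
  have h2 : Commute (y e b) (y d b) := hy.comm _ _ _ _ heb hdb hbd hbe.symm
  refine commutatorElement_eq_of_left (hy.mul d e b hde heb hdb) (hy.mul a d e hd.symm hde he.symm)
    rfl (hy.comm _ _ _ _ hd.symm heb hde' hab) h1 ?_
  rw [commutatorElement_def]
  exact ((h1.mul_left h2).mul_left h1.inv_left).mul_left h2.inv_left

/-- Here d and e may share a block, so both are compared with an index in a block different from
theirs. -/
theorem commutatorElement_eq (hy : BlockSteinbergFamily k y) (hc : ∀ i, k (c i) = i) {a b d e : I}
    (hab : a ≠ b) (hk : k a = k b) (hd : k d ≠ k a) (he : k e ≠ k a) :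
    ⁅y a d, y d b⁆ = ⁅y a e, y e b⁆ := by
  obtain ⟨m, hma, hmd, hme⟩ := Fin.exists_ne_three (k a) (k d) (k e)
  rw [← hc m] at hma hmd hme
  exact (hy.commutatorElement_eq_of_ne hab hk hd hma hmd.symm).trans
    (hy.commutatorElement_eq_of_ne hab hk hma he hme)

theorem blockExtension_eq (hy : BlockSteinbergFamily k y) (hc : ∀ i, k (c i) = i) {a b d : I}
    (hab : a ≠ b) (hda : k d ≠ k a) (hdb : k d ≠ k b) :
    ⁅y a d, y d b⁆ = blockExtension k c y a b := by
  by_cases hk : k a = k b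
  · rw [blockExtension, if_neg (not_not.2 hk)]
    refine hy.commutatorElement_eq hc hab hk hda ?_
    rw [hc]
    generalize k a = i
    decide +revert
  · rw [blockExtension_of_ne hk, hy.mul _ _ _ hda.symm hdb hk]

/-- By independence of the intermediate index, it can be moved away from the blocks of p and q. Then
both entries of the commutator commute with y_{pq}. -/
theorem commute_blockExtension_of_ne (hy : BlockSteinbergFamily k y) (hc : ∀ i, k (c i) = i)
    {a b p q : I} (hab : a ≠ b) (hpq : k p ≠ k q) (hbp : b ≠ p) (haq : a ≠ q) :
    Commute (blockExtension k c y a b) (y p q) := by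
  by_cases hk : k a = k b
  · obtain ⟨m, hma, hmp, hmq⟩ := Fin.exists_ne_three (k a) (k p) (k q)
    rw [← hc m] at hma hmp hmq
    set d := c m
    have hdb : k d ≠ k b := hk ▸ hma
    have hdp : d ≠ p := fun h => hmp (h ▸ rfl)
    have hdq : d ≠ q := fun h => hmq (h ▸ rfl)
    rw [← hy.blockExtension_eq hc hab hma hdb, commutatorElement_def]
    have h1 : Commute (y a d) (y p q) := hy.comm _ _ _ _ hma.symm hpq hdp haq
    have h2 : Commute (y d b) (y p q) := hy.comm _ _ _ _ hdb hpq hbp hdq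
    exact ((h1.mul_left h2).mul_left h1.inv_left).mul_left h2.inv_left
  · rw [blockExtension_of_ne hk]
    exact hy.comm _ _ _ _ hk hpq hbp haq

theorem commute_blockExtension (hy : BlockSteinbergFamily k y) (hc : ∀ i, k (c i) = i)
    {a b p q : I} (hab : a ≠ b) (hpq : p ≠ q) (hbp : b ≠ p) (haq : a ≠ q) :
    Commute (blockExtension k c y a b) (blockExtension k c y p q) := by
  by_cases hk : k p = k q
  · obtain ⟨m, hmp, hma, hmb⟩ := Fin.exists_ne_three (k p) (k a) (k b)
    rw [← hc m] at hmp hma hmb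
    set d := c m
    have hdq : k d ≠ k q := hk ▸ hmp
    have hda : a ≠ d := fun h => hma (h ▸ rfl)
    have hdb : b ≠ d := fun h => hmb (h ▸ rfl)
    rw [← hy.blockExtension_eq hc hpq hmp hdq, commutatorElement_def]
    have h1 := hy.commute_blockExtension_of_ne hc hab hmp.symm hbp hda
    have h2 := hy.commute_blockExtension_of_ne hc hab hdq hdb haq
    exact ((h1.mul_right h2).mul_right h1.inv_right).mul_right h2.inv_right
  · rw [blockExtension_of_ne hk]
    exact hy.commute_blockExtension_of_ne hc hab hk hbp haq

theorem blockExtension_mul_of_ne (hy : BlockSteinbergFamily k y) (hc : ∀ i, k (c i) = i)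
    {a b e : I} (hab : a ≠ b) (hea : k e ≠ k a) (heb : k e ≠ k b) :
    ⁅blockExtension k c y a b, y b e⁆ = y a e := by
  by_cases hk : k a = k b
  · obtain ⟨m, hma, hmb, hme⟩ := Fin.exists_ne_three (k a) (k b) (k e)
    rw [← hc m] at hma hmb hme
    set f := c m
    have hfe : f ≠ e := fun h => hme (h ▸ rfl)
    have hbf : b ≠ f := fun h => hmb (h ▸ rfl)
    have hae : a ≠ e := fun h => hea (h ▸ rfl)
    have hbe : b ≠ e := fun h => heb (h ▸ rfl)
    have haf : a ≠ f := fun h => hma (h ▸ rfl)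
    exact commutatorElement_eq_of_right (hy.blockExtension_eq hc hab hma hmb)
      (hy.mul f b e hmb heb.symm hme) (hy.mul a f e hma.symm hme hea.symm)
      (hy.comm a f b e hma.symm heb.symm hbf.symm hae)
      (hy.commute_blockExtension_of_ne hc hab hme hbf hae).symm
      (hy.comm a e f e hea.symm hme hfe.symm hae)
  · rw [blockExtension_of_ne hk]
    exact hy.mul _ _ _ hk heb.symm hea.symm

/-- A Steinberg family on pairs of indices in different blocks extends to all pairs. -/
theorem steinbergFamily (hy : BlockSteinbergFamily k y) (hc : ∀ i, k (c i) = i) :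
    SteinbergFamily (blockExtension k c y) where
  comm _ _ _ _ := hy.commute_blockExtension hc
  mul a b d hab hbd had := by
    obtain ⟨m, hma, hmb, hmd⟩ := Fin.exists_ne_three (k a) (k b) (k d)
    rw [← hc m] at hma hmb hmd
    set e := c m
    have hbe : b ≠ e := fun h => hmb (h ▸ rfl)
    refine commutatorElement_eq_of_left (hy.blockExtension_eq hc hbd hmb hmd)
      (hy.blockExtension_mul_of_ne hc hab hma hmb) (hy.blockExtension_eq hc had hma hmd)
      (hy.commute_blockExtension_of_ne hc hab hmd hbe had)
      (hy.commute_blockExtension_of_ne hc hbd hma.symm had.symm hbe).symm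
      (hy.commute_blockExtension hc had hbd hbd.symm had)

end BlockSteinbergFamily

end BlockFamily

/-! ### Units 1 + x with x² = 0. -/

section ElementaryUnits

variable {T : Type*} [Ring T]

open Classical in
/-- The unit `1 + x` attached to an element of square zero. -/
noncomputable def elemUnit (x : T) : Tˣ :=
  if h : x * x = 0 then
    ⟨1 + x, 1 - x, by rw [add_mul, mul_sub, mul_sub, h]; simp, by
      rw [sub_mul, mul_add, mul_add, h]; simp⟩
  else 1

theorem elemUnit_val {x : T} (h : x * x = 0) : (elemUnit x : T) = 1 + x := by
  rw [elemUnit, dif_pos h]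

theorem elemUnit_mul {x y : T} (hx : x * x = 0) (hy : y * y = 0) (hxy : x * y = 0)
    (hyx : y * x = 0) : elemUnit x * elemUnit y = elemUnit (x + y) := by
  have h : (x + y) * (x + y) = 0 := by simp [add_mul, mul_add, hx, hy, hxy, hyx]
  ext
  rw [Units.val_mul, elemUnit_val hx, elemUnit_val hy, elemUnit_val h]
  simp [add_mul, mul_add, hxy, add_assoc, add_comm y]

theorem elemUnit_commute {x y : T} (hx : x * x = 0) (hy : y * y = 0) (hxy : x * y = 0)
    (hyx : y * x = 0) : Commute (elemUnit x) (elemUnit y) := by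
  rw [Commute, SemiconjBy, elemUnit_mul hx hy hxy hyx, elemUnit_mul hy hx hyx hxy, add_comm]

theorem commutatorElement_elemUnit {x y z : T} (hx : x * x = 0) (hy : y * y = 0) (hz : z * z = 0)
    (hxy : x * y = z) (hyx : y * x = 0) : ⁅elemUnit x, elemUnit y⁆ = elemUnit z := by
  have hzx : z * x = 0 := by rw [← hxy, mul_assoc, hyx, mul_zero]
  have hzy : z * y = 0 := by rw [← hxy, mul_assoc, hy, mul_zero]
  rw [commutatorElement_def, mul_inv_eq_iff_eq_mul, mul_inv_eq_iff_eq_mul]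
  ext
  simp only [Units.val_mul, elemUnit_val hx, elemUnit_val hy, elemUnit_val hz, add_mul, mul_add,
    one_mul, mul_one, hxy, hyx, hzx, hzy, add_zero]
  abel

end ElementaryUnits

/-! ### Steinberg groups and their representations by matrix units. -/

namespace Steinberg

variable {ι R : Type*} [Ring R]

theorem mk_eq_one {w : FreeGroup (SteinbergGen ι R)} (h : SteinbergRel ι R w) :
    PresentedGroup.mk {w | SteinbergRel ι R w} w = 1 :=
  PresentedGroup.one_of_mem h

theorem e_mul_e {i j : ι} (h : i ≠ j) (r s : R) : e i j h r * e i j h s = e i j h (r + s) := by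
  have := mk_eq_one (SteinbergRel.add i j h r s)
  rw [map_mul, map_inv, map_mul, mul_inv_eq_one] at this
  exact this

theorem commutatorElement_e {i j l : ι} (hij : i ≠ j) (hjl : j ≠ l) (hil : i ≠ l) (r s : R) :
    ⁅e i j hij r, e j l hjl s⁆ = e i l hil (r * s) := by
  have := mk_eq_one (SteinbergRel.mul i j l hij hjl hil r s)
  rw [map_mul, map_inv, map_commutatorElement, mul_inv_eq_one] at this
  exact this

theorem e_commute {i j p q : ι} (hij : i ≠ j) (hpq : p ≠ q) (hjp : j ≠ p) (hiq : i ≠ q)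
    (r s : R) : Commute (e i j hij r) (e p q hpq s) := by
  have := mk_eq_one (SteinbergRel.comm i j p q hij hpq hjp hiq r s)
  rw [map_commutatorElement, commutatorElement_eq_one_iff_commute] at this
  exact this

theorem e_zero {i j : ι} (h : i ≠ j) : e i j h (0 : R) = 1 := by
  have := e_mul_e h (0 : R) 0
  rwa [add_zero, mul_eq_left] at this

/-- The elements `e_{ij}(r)` with fixed `i`, `j` as a homomorphism. -/
def eHom (i j : ι) (h : i ≠ j) : Multiplicative R →* Steinberg ι R where
  toFun r := e i j h r.toAdd
  map_one' := e_zero h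
  map_mul' r s := (e_mul_e h r.toAdd s.toAdd).symm

/-- The representation `e_{ij}(r) ↦ 1 + μ_{ij}(r)` attached to a system of matrix units. -/
noncomputable def rep {T : Type*} [Ring T] (μ : ι → ι → R →+ T)
    (hmul : ∀ i j l a b, μ i j a * μ j l b = μ i l (a * b))
    (hzero : ∀ i j p q a b, j ≠ p → μ i j a * μ p q b = 0) : Steinberg ι R →* Tˣ :=
  PresentedGroup.toGroup (f := fun g => elemUnit (μ g.row g.col g.coeff)) (by
    rintro w (⟨i, j, hij, r, s⟩ | ⟨i, j, l, hij, hjl, hil, r, s⟩ |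
      ⟨i, j, p, q, hij, hpq, hjp, hiq, r, s⟩)
    · simp only [map_mul, map_inv, FreeGroup.lift_apply_of, mul_inv_eq_one]
      rw [elemUnit_mul, map_add] <;> exact hzero _ _ _ _ _ _ hij.symm
    · simp only [map_mul, map_inv, map_commutatorElement, FreeGroup.lift_apply_of, mul_inv_eq_one]
      exact commutatorElement_elemUnit (hzero _ _ _ _ _ _ hij.symm) (hzero _ _ _ _ _ _ hjl.symm)
        (hzero _ _ _ _ _ _ hil.symm) (hmul _ _ _ _ _) (hzero _ _ _ _ _ _ hil.symm)
    · simp only [map_commutatorElement, FreeGroup.lift_apply_of]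
      rw [commutatorElement_eq_one_iff_commute]
      exact elemUnit_commute (hzero _ _ _ _ _ _ hij.symm) (hzero _ _ _ _ _ _ hpq.symm)
        (hzero _ _ _ _ _ _ hjp) (hzero _ _ _ _ _ _ hiq.symm))

theorem rep_e {T : Type*} [Ring T] (μ : ι → ι → R →+ T)
    (hmul : ∀ i j l a b, μ i j a * μ j l b = μ i l (a * b))
    (hzero : ∀ i j p q a b, j ≠ p → μ i j a * μ p q b = 0) {i j : ι} (h : i ≠ j) (r : R) :
    rep μ hmul hzero (e i j h r) = elemUnit (μ i j r) :=
  PresentedGroup.toGroup.of _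

end Steinberg

/-- With s = pq + qp idempotent and n = q − p, one has n² = −s and sn = ns = n. The product is 1 − s
+ n, its square is 1 − 2s, and the square of that is 1. -/
theorem elemUnit_quarter_turn_pow_four {T : Type*} [Ring T] {p q : T} (hp : p * p = 0)
    (hq : q * q = 0) (hpqp : p * q * p = p) (hqpq : q * p * q = q) :
    (elemUnit (-p) * elemUnit q * elemUnit (-p)) ^ 4 = 1 := by
  have hp' : -p * -p = 0 := by rw [neg_mul_neg, hp]
  have h1 : ((elemUnit (-p) * elemUnit q * elemUnit (-p) : Tˣ) : T)
      = 1 - (p * q + q * p) + (q - p) := by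
    rw [Units.val_mul, Units.val_mul, elemUnit_val hp', elemUnit_val hq]
    have : (1 + -p) * (1 + q) * (1 + -p)
        = 1 + q - p - p - p * q - q * p + p * p + p * q * p := by noncomm_ring
    rw [this, hp, hpqp]; abel
  have e1 : (p * q + q * p) * (p * q + q * p) = p * q + q * p := by
    have : (p * q + q * p) * (p * q + q * p)
      = p * q * p * q + p * (q * q) * p + q * (p * p) * q + q * p * q * p := by noncomm_ring
    rw [this, hpqp, hqpq, hp, hq]; simp
  have e2 : (p * q + q * p) * (q - p) = q - p := by
    have : (p * q + q * p) * (q - p) = p * (q * q) - p * q * p + q * p * q - q * (p * p) := by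
      noncomm_ring
    rw [this, hpqp, hqpq, hp, hq]; simp; abel
  have e3 : (q - p) * (p * q + q * p) = q - p := by
    have : (q - p) * (p * q + q * p) = q * p * q + q * q * p - p * p * q - p * q * p := by
      noncomm_ring
    rw [this, hpqp, hqpq, hp, hq]; simp
  have e4 : (q - p) * (q - p) = -(p * q + q * p) := by
    have : (q - p) * (q - p) = q * q - q * p - p * q + p * p := by noncomm_ring
    rw [this, hp, hq]; abel
  ext
  rw [Units.val_pow_eq_pow_val, h1, Units.val_one]
  set s := p * q + q * p
  set n := q - p
  have h2 : (1 - s + n) * (1 - s + n) = 1 - s - s := by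
    have : (1 - s + n) * (1 - s + n) = 1 - s - s + s * s + n + n - s * n - n * s + n * n := by
      noncomm_ring
    rw [this, e1, e2, e3, e4]; abel
  have h3 : (1 - s - s) * (1 - s - s) = 1 - s - s - s - s + s * s + s * s + s * s + s * s := by
    noncomm_ring
  rw [pow_succ, pow_succ, pow_two, mul_assoc, h2, h3, e1]; abel

/-! ### Block matrices over Mat_S(ℤ) as ℕ × ℕ matrices. -/

namespace RCFMatrix

variable {S : Type*}

theorem ext_entry {a b : RCFMatrix S} (h : ∀ i j, a.entry i j = b.entry i j) : a = b :=
  RCFMatrix.ext (funext fun i => funext fun j => h i j)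

open Classical in
theorem single_entry (s t i j : S) : (single s t).entry i j = if i = s ∧ j = t then 1 else 0 := rfl

open Classical in
theorem one_entry (i j : S) : (1 : RCFMatrix S).entry i j = if i = j then 1 else 0 := rfl

open Classical in
theorem single_mul_entry (s t : S) (a : RCFMatrix S) (i j : S) :
    (single s t * a).entry i j = if i = s then a.entry t j else 0 := by
  rw [mul_entry_of_row _ _ _ _ {t}]
  · simp [single_entry]
  · intro k hk
    by_contra h
    refine hk (if_neg fun e => h ?_)
    simp [e.2]

theorem single_mul_single (s t u : S) : single s t * single t u = single s u := by
  classical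
  refine ext_entry fun i j => ?_
  rw [single_mul_entry, single_entry, single_entry]
  grind

theorem single_mul_single_of_ne (s u : S) {t t' : S} (h : t ≠ t') :
    single s t * single t' u = 0 := by
  classical
  refine ext_entry fun i j => ?_
  rw [single_mul_entry, single_entry, zero_entry]
  grind

/-- The matrix with a single non-zero block `A`, in the row block `i` and the column block `j`,
where `θ` enumerates the rows and columns. -/
def spread (θ : ℕ ≃ S × Fin 4) (i j : Fin 4) : RCFMatrix S →+ RCFMatrix ℕ where
  toFun A :=
    { entry := fun p q => if (θ p).2 = i ∧ (θ q).2 = j then A.entry (θ p).1 (θ q).1 else 0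
      row_finite := fun p => ((A.row_finite (θ p).1).image fun t => θ.symm (t, j)).subset (by
        intro q hq
        simp only [Set.mem_ofPred_eq, ne_eq, ite_eq_right_iff, not_forall] at hq
        obtain ⟨⟨_, rfl⟩, h⟩ := hq
        exact ⟨_, h, by simp⟩)
      col_finite := fun q => ((A.col_finite (θ q).1).image fun t => θ.symm (t, i)).subset (by
        intro p hp
        simp only [Set.mem_ofPred_eq, ne_eq, ite_eq_right_iff, not_forall] at hp
        obtain ⟨⟨rfl, _⟩, h⟩ := hp
        exact ⟨_, h, by simp⟩) }
  map_zero' := ext_entry fun p q => by simp [zero_entry]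
  map_add' A B := ext_entry fun p q => by
    simp only [add_entry]
    split_ifs <;> simp

theorem spread_entry (θ : ℕ ≃ S × Fin 4) (i j : Fin 4) (A : RCFMatrix S) (p q : ℕ) :
    (spread θ i j A).entry p q
      = if (θ p).2 = i ∧ (θ q).2 = j then A.entry (θ p).1 (θ q).1 else 0 := rfl

theorem spread_single (θ : ℕ ≃ S × Fin 4) (i j : Fin 4) (s t : S) :
    spread θ i j (single s t) = single (θ.symm (s, i)) (θ.symm (t, j)) := by
  classical
  refine ext_entry fun p q => ?_
  rw [spread_entry, single_entry, single_entry]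
  simp only [Equiv.eq_symm_apply, Prod.ext_iff]
  grind

theorem spread_mul_spread_of_ne (θ : ℕ ≃ S × Fin 4) (i l : Fin 4) {j j' : Fin 4} (h : j ≠ j')
    (A B : RCFMatrix S) : spread θ i j A * spread θ j' l B = 0 := by
  refine ext_entry fun p q => ?_
  rw [mul_entry, zero_entry]
  refine finsum_eq_zero_of_forall_eq_zero fun r => ?_
  rw [spread_entry, spread_entry]
  grind

theorem spread_mul_spread (θ : ℕ ≃ S × Fin 4) (i j l : Fin 4) (A B : RCFMatrix S) :
    spread θ i j A * spread θ j l B = spread θ i l (A * B) := by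
  classical
  refine ext_entry fun p q => ?_
  have hinj : Function.Injective fun t => θ.symm (t, j) := fun s t h => by simpa using h
  rw [mul_entry_of_row _ _ _ _ ((A.row_finite (θ p).1).toFinset.map ⟨_, hinj⟩), spread_entry,
    Finset.sum_map, mul_entry_of_row A B _ _ (A.row_finite (θ p).1).toFinset (by simp)]
  · simp only [spread_entry, Function.Embedding.coeFn_mk, Equiv.apply_symm_apply, and_true,
      true_and]
    split_ifs <;> simp_all
  · intro r hr
    rw [spread_entry] at hr
    simp only [ne_eq, ite_eq_right_iff, not_forall] at hr
    obtain ⟨⟨_, rfl⟩, h⟩ := hr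
    simp only [Finset.mem_map, Set.Finite.mem_toFinset, Set.mem_ofPred_eq,
      Function.Embedding.coeFn_mk]
    exact ⟨_, h, by simp⟩

end RCFMatrix

/-! ### Generation of SL_n(ℤ) by transvections. -/

section Generation

/-- The subgroup of `SL_ι(ℤ)` generated by the transvections. -/
def transvectionSubgroup (ι : Type*) [DecidableEq ι] [Fintype ι] :
    Subgroup (Matrix.SpecialLinearGroup ι ℤ) :=
  Subgroup.closure {g | ∃ (i j : ι) (h : i ≠ j) (c : ℤ),
    g = Matrix.SpecialLinearGroup.transvection h c}

section Vectors

variable {ι : Type*} [DecidableEq ι] [Fintype ι]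

theorem transvection_mem_transvectionSubgroup {i j : ι} (h : i ≠ j) (c : ℤ) :
    Matrix.SpecialLinearGroup.transvection h c ∈ transvectionSubgroup ι :=
  Subgroup.subset_closure ⟨i, j, h, c, rfl⟩

theorem transvection_smul {i j : ι} (h : i ≠ j) (c : ℤ) (v : ι → ℤ) :
    Matrix.SpecialLinearGroup.transvection h c • v = shear i j c v := by
  rw [Matrix.SpecialLinearGroup.smul_def, Matrix.SpecialLinearGroup.transvection_coe,
    Matrix.smul_eq_mulVec, Matrix.add_mulVec, Matrix.one_mulVec,
    Matrix.single_mulVec_eq]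
  ext e
  by_cases he : e = i
  · subst he
    simp [shear, mul_comm]
  · simp [shear, he]

theorem exists_smul_eq_single {v : ι → ℤ} (hv : v ≠ 0) :
    ∃ L ∈ transvectionSubgroup ι, ∃ a m, m ≠ 0 ∧ L • v = Pi.single a m := by
  induction h : l1 v using Nat.strong_induction_on generalizing v with
  | _ n ih =>
    rcases exists_reduces_or_eq_single hv with ⟨a, b, ε, hr⟩ | ⟨a, m, hm, rfl⟩
    · obtain ⟨L, hL, c, m, hm, e⟩ := ih _ (h ▸ hr.l1_lt) (shear_ne_zero hr.ne _ hv) rfl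
      refine ⟨L * Matrix.SpecialLinearGroup.transvection hr.ne (ε : ℤ),
        mul_mem hL (transvection_mem_transvectionSubgroup _ _), c, m, hm, ?_⟩
      rw [mul_smul, transvection_smul, e]
    · exact ⟨1, one_mem _, a, m, hm, one_smul _ _⟩

/-- One shear copies the entry from b to a with sign ε; the second clears b, because ε² = 1. -/
theorem exists_smul_single_eq {a b : ι} (hab : a ≠ b) (ε : ℤˣ) (m : ℤ) :
    ∃ L ∈ transvectionSubgroup ι, L • (Pi.single b m : ι → ℤ) = Pi.single a (ε * m) := by
  refine ⟨Matrix.SpecialLinearGroup.transvection hab.symm (-(ε : ℤ)) *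
      Matrix.SpecialLinearGroup.transvection hab (ε : ℤ),
    mul_mem (transvection_mem_transvectionSubgroup _ _)
      (transvection_mem_transvectionSubgroup _ _), ?_⟩
  rw [mul_smul, transvection_smul, transvection_smul]
  ext e
  by_cases hb : e = b
  · subst hb
    rw [shear_apply_self, shear_apply_self, shear_apply_of_ne _ _ _ hab.symm,
      Pi.single_eq_of_ne hab, Pi.single_eq_same, Pi.single_eq_of_ne hab.symm]
    rcases Int.units_eq_one_or ε with rfl | rfl <;> simp
  · rw [shear_apply_of_ne _ _ _ hb]
    by_cases ha : e = a
    · subst ha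
      rw [shear_apply_self, Pi.single_eq_same, Pi.single_eq_same, Pi.single_eq_of_ne hab, zero_add]
    · rw [shear_apply_of_ne _ _ _ ha, Pi.single_eq_of_ne ha, Pi.single_eq_of_ne hb]

/-- Moving an entry to another position allows a free choice of sign. An entry already at a takes a
round trip through a second index. -/
theorem exists_smul_eq_single_pos [Nontrivial ι] (a : ι) {v : ι → ℤ} (hv : v ≠ 0) :
    ∃ L ∈ transvectionSubgroup ι, ∃ m, 0 < m ∧ L • v = Pi.single a m := by
  have key {b : ι} (hab : a ≠ b) {m : ℤ} (hm : m ≠ 0) :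
      ∃ L ∈ transvectionSubgroup ι, ∃ m', 0 < m' ∧
        L • (Pi.single b m : ι → ℤ) = Pi.single a m' := by
    rcases hm.lt_or_gt with hm | hm
    · obtain ⟨L, hL, e⟩ := exists_smul_single_eq hab (-1) m
      exact ⟨L, hL, _, by simpa using hm, e⟩
    · obtain ⟨L, hL, e⟩ := exists_smul_single_eq hab 1 m
      exact ⟨L, hL, _, by simpa using hm, e⟩
  obtain ⟨L, hL, c, m, hm, e⟩ := exists_smul_eq_single hv
  by_cases hac : a = c
  · subst hac
    obtain ⟨b, hb⟩ := exists_ne a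
    obtain ⟨L', hL', e'⟩ := exists_smul_single_eq hb 1 m
    obtain ⟨L'', hL'', m', hm', e''⟩ := key hb.symm (m := (1 : ℤˣ) * m) (by simpa using hm)
    refine ⟨L'' * (L' * L), mul_mem hL'' (mul_mem hL' hL), m', hm', ?_⟩
    rw [mul_smul, mul_smul, e, e', e'']
  · obtain ⟨L', hL', m', hm', e'⟩ := key hac hm
    refine ⟨L' * L, mul_mem hL' hL, m', hm', ?_⟩
    rw [mul_smul, e, e']

end Vectors

/-- The block matrix `diag(1, D)`. -/
def consOne {n : ℕ} (D : Matrix (Fin n) (Fin n) ℤ) : Matrix (Fin (n + 1)) (Fin (n + 1)) ℤ :=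
  Matrix.of (Fin.cons (Fin.cons 1 fun _ => 0) fun i => Fin.cons 0 fun j => D i j)

theorem consOne_zero_zero {n : ℕ} (D : Matrix (Fin n) (Fin n) ℤ) : consOne D 0 0 = 1 := rfl

theorem consOne_zero_succ {n : ℕ} (D : Matrix (Fin n) (Fin n) ℤ) (j : Fin n) :
    consOne D 0 j.succ = 0 := rfl

theorem consOne_succ_zero {n : ℕ} (D : Matrix (Fin n) (Fin n) ℤ) (i : Fin n) :
    consOne D i.succ 0 = 0 := rfl

theorem consOne_succ_succ {n : ℕ} (D : Matrix (Fin n) (Fin n) ℤ) (i j : Fin n) :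
    consOne D i.succ j.succ = D i j := rfl

theorem matrix_ext_succ {n : ℕ} {A B : Matrix (Fin (n + 1)) (Fin (n + 1)) ℤ}
    (h00 : A 0 0 = B 0 0) (h0s : ∀ j : Fin n, A 0 j.succ = B 0 j.succ)
    (hs0 : ∀ i : Fin n, A i.succ 0 = B i.succ 0)
    (hss : ∀ i j : Fin n, A i.succ j.succ = B i.succ j.succ) : A = B := by
  ext i j
  refine Fin.cases ?_ (fun i => ?_) i <;> refine Fin.cases ?_ (fun j => ?_) j
  · exact h00
  · exact h0s j
  · exact hs0 i
  · exact hss i j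

theorem consOne_mul {n : ℕ} (D D' : Matrix (Fin n) (Fin n) ℤ) :
    consOne (D * D') = consOne D * consOne D' := by
  refine matrix_ext_succ ?_ (fun j => ?_) (fun i => ?_) (fun i j => ?_) <;>
    simp [Matrix.mul_apply, Fin.sum_univ_succ, consOne_zero_zero, consOne_zero_succ,
      consOne_succ_zero, consOne_succ_succ]

theorem consOne_transvection {n : ℕ} (i j : Fin n) (c : ℤ) :
    consOne (Matrix.transvection i j c) = Matrix.transvection i.succ j.succ c := by
  refine matrix_ext_succ ?_ (fun j => ?_) (fun i => ?_) (fun i j => ?_) <;>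
    simp [Matrix.transvection, consOne_zero_zero, consOne_zero_succ,
      consOne_succ_zero, consOne_succ_succ, Matrix.one_apply, Matrix.single_apply,
      Fin.succ_ne_zero, (Fin.succ_ne_zero _).symm]

theorem consOne_one (n : ℕ) : consOne (1 : Matrix (Fin n) (Fin n) ℤ) = 1 := by
  refine matrix_ext_succ ?_ (fun j => ?_) (fun i => ?_) (fun i j => ?_) <;>
    simp [consOne_zero_zero, consOne_zero_succ,
      consOne_succ_zero, consOne_succ_succ, Matrix.one_apply,
      Fin.succ_ne_zero, (Fin.succ_ne_zero _).symm]

theorem det_of_column_zero {n : ℕ} {A : Matrix (Fin (n + 1)) (Fin (n + 1)) ℤ}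
    (h : ∀ i : Fin n, A i.succ 0 = 0) : A.det = A 0 0 * (A.submatrix Fin.succ Fin.succ).det := by
  rw [Matrix.det_succ_column_zero, Fin.sum_univ_succ]
  simp [h]

theorem det_consOne {n : ℕ} (D : Matrix (Fin n) (Fin n) ℤ) : (consOne D).det = D.det := by
  rw [det_of_column_zero (consOne_succ_zero D), consOne_zero_zero, one_mul]
  rfl

/-- The embedding `D ↦ diag(1, D)` of special linear groups. -/
def consOneHom (n : ℕ) :
    Matrix.SpecialLinearGroup (Fin n) ℤ →* Matrix.SpecialLinearGroup (Fin (n + 1)) ℤ where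
  toFun D := ⟨consOne D.1, by rw [det_consOne, D.2]⟩
  map_one' := Subtype.ext (consOne_one n)
  map_mul' D D' := Subtype.ext (consOne_mul D.1 D'.1)

theorem consOneHom_mem {n : ℕ} {D : Matrix.SpecialLinearGroup (Fin n) ℤ}
    (hD : D ∈ transvectionSubgroup (Fin n)) :
    consOneHom n D ∈ transvectionSubgroup (Fin (n + 1)) := by
  have h : transvectionSubgroup (Fin n)
      ≤ (transvectionSubgroup (Fin (n + 1))).comap (consOneHom n) := by
    rw [transvectionSubgroup, Subgroup.closure_le]
    rintro _ ⟨i, j, hij, c, rfl⟩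
    have e : consOneHom n (Matrix.SpecialLinearGroup.transvection hij c)
        = Matrix.SpecialLinearGroup.transvection ((Fin.succ_injective n).ne hij) c :=
      Subtype.ext (consOne_transvection i j c)
    change consOneHom n _ ∈ transvectionSubgroup (Fin (n + 1))
    rw [e]
    exact transvection_mem_transvectionSubgroup _ _
  exact h hD

theorem exists_row_mem {n : ℕ} (r : Fin n → ℤ) (T : Finset (Fin n)) :
    ∃ L ∈ transvectionSubgroup (Fin (n + 1)),
      L.1 = 1 + ∑ j ∈ T, Matrix.single (0 : Fin (n + 1)) j.succ (r j) := by
  induction T using Finset.induction_on with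
  | empty => exact ⟨1, one_mem _, by simp⟩
  | insert j T hj ih =>
    obtain ⟨L, hL, e⟩ := ih
    refine ⟨L * Matrix.SpecialLinearGroup.transvection (Fin.succ_ne_zero j).symm (r j),
      mul_mem hL (transvection_mem_transvectionSubgroup _ _), ?_⟩
    have hz : ∑ k ∈ T, Matrix.single (0 : Fin (n + 1)) k.succ (r k)
        * Matrix.single (0 : Fin (n + 1)) j.succ (r j) = 0 :=
      Finset.sum_eq_zero fun k _ => Matrix.single_mul_single_of_ne _ _ _ _ (Fin.succ_ne_zero k) _
    rw [Matrix.SpecialLinearGroup.coe_mul, e, Matrix.SpecialLinearGroup.transvection_coe, mul_add,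
      mul_one, add_mul, one_mul, Finset.sum_mul, Finset.sum_insert hj, hz]
    abel

/-- `SL_n(ℤ)` is generated by transvections. -/
theorem transvectionSubgroup_fin_eq_top (n : ℕ) : transvectionSubgroup (Fin n) = ⊤ := by
  induction n with
  | zero => exact Subsingleton.elim _ _
  | succ n ih =>
    rw [eq_top_iff]
    rintro g -
    -- A matrix whose first column is e_0 is diag(1, D) times a product of transvections in row 0,
    -- and D has determinant 1.
    have key (h : Matrix.SpecialLinearGroup (Fin (n + 1)) ℤ) (h00 : h.1 0 0 = 1)
        (hs0 : ∀ i : Fin n, h.1 i.succ 0 = 0) : h ∈ transvectionSubgroup (Fin (n + 1)) := by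
      have hdet : (h.1.submatrix Fin.succ Fin.succ).det = 1 := by
        have := det_of_column_zero hs0
        rwa [h.2, h00, one_mul, eq_comm] at this
      have hD : consOneHom n ⟨_, hdet⟩ ∈ transvectionSubgroup (Fin (n + 1)) :=
        consOneHom_mem (by rw [ih]; trivial)
      obtain ⟨L, hL, e⟩ := exists_row_mem (fun j => h.1 0 j.succ) Finset.univ
      have : h = consOneHom n ⟨_, hdet⟩ * L := by
        refine Subtype.ext ?_
        rw [Matrix.SpecialLinearGroup.coe_mul, e]
        change h.1 = consOne (h.1.submatrix Fin.succ Fin.succ) * _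
        refine matrix_ext_succ ?_ (fun j => ?_) (fun i => ?_) (fun i j => ?_) <;>
          simp [mul_add, Matrix.add_apply, Matrix.mul_apply, Matrix.sum_apply,
            Fin.sum_univ_succ, consOne_zero_zero, consOne_zero_succ, consOne_succ_zero,
            consOne_succ_succ, h00, hs0, Matrix.single_apply, Matrix.one_apply, Fin.succ_ne_zero,
            (Fin.succ_ne_zero _).symm]
      rw [this]
      exact mul_mem hD hL
    rcases Nat.eq_zero_or_pos n with rfl | hn
    · refine key g ?_ fun i => i.elim0
      have := g.2
      rwa [Matrix.det_fin_one] at this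
    · have : Nontrivial (Fin (n + 1)) := Fin.nontrivial_iff_two_le.2 (by omega)
      have hv : g • (Pi.single 0 1 : Fin (n + 1) → ℤ) ≠ 0 := by
        rw [Ne, smul_eq_zero_iff_eq]
        simp
      obtain ⟨L, hL, m, hm, e⟩ := exists_smul_eq_single_pos 0 hv
      have hcol (i : Fin (n + 1)) : (L * g).1 i 0 = (Pi.single 0 m : Fin (n + 1) → ℤ) i := by
        rw [← e, ← mul_smul, Matrix.SpecialLinearGroup.smul_def, Matrix.smul_eq_mulVec,
          Matrix.mulVec_single_one]
        rfl
      have hs0 (i : Fin n) : (L * g).1 i.succ 0 = 0 := by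
        rw [hcol, Pi.single_eq_of_ne (Fin.succ_ne_zero i)]
      -- Expansion along the first column makes m a positive divisor of 1.
      have h00 : (L * g).1 0 0 = 1 := by
        have h := det_of_column_zero hs0
        rw [(L * g).2, hcol, Pi.single_eq_same] at h
        rw [hcol, Pi.single_eq_same]
        exact Int.eq_one_of_mul_eq_one_right hm.le h.symm
      have := key _ h00 hs0
      exact (Subgroup.mul_mem_cancel_left _ hL).1 this

end Generation

/-! ### Generation of SL_∞(ℤ) by elementary matrices. -/

section InfiniteSpecialLinear

open RCFMatrix

theorem RCFMatrix.single_mul_self {S : Type*} {a b : S} (h : a ≠ b) : single a b * single a b = 0 :=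
  single_mul_single_of_ne _ _ h.symm

/-- The group of infinite matrices generated by the elementary matrices `1 + E_{ab}`. -/
noncomputable def elementarySubgroup : Subgroup (RCFMatrix ℕ)ˣ :=
  Subgroup.closure {g | ∃ a b : ℕ, a ≠ b ∧ g = elemUnit (single a b)}

/-- The infinite matrix `A ⊕ 1`. -/
def RCFMatrix.stabilize {n : ℕ} (A : Matrix (Fin n) (Fin n) ℤ) : RCFMatrix ℕ where
  entry i j := if h : i < n ∧ j < n then A ⟨i, h.1⟩ ⟨j, h.2⟩ else if i = j then 1 else 0
  row_finite i := (Set.finite_Iio (max n (i + 1))).subset fun j hj => by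
    simp only [Set.mem_ofPred_eq, Set.mem_Iio] at hj ⊢
    by_contra h
    rw [dif_neg (by omega), if_neg (by omega)] at hj
    exact hj rfl
  col_finite j := (Set.finite_Iio (max n (j + 1))).subset fun i hi => by
    simp only [Set.mem_ofPred_eq, Set.mem_Iio] at hi ⊢
    by_contra h
    rw [dif_neg (by omega), if_neg (by omega)] at hi
    exact hi rfl

theorem RCFMatrix.stabilize_entry {n : ℕ} (A : Matrix (Fin n) (Fin n) ℤ) (i j : ℕ) :
    (stabilize A).entry i j
      = if h : i < n ∧ j < n then A ⟨i, h.1⟩ ⟨j, h.2⟩ else if i = j then 1 else 0 := rfl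

theorem RCFMatrix.stabilize_one (n : ℕ) :
    stabilize (1 : Matrix (Fin n) (Fin n) ℤ) = 1 := by
  classical
  refine ext_entry fun i j => ?_
  rw [stabilize_entry, one_entry]
  by_cases h : i < n ∧ j < n
  · simp [h, Matrix.one_apply]
  · rw [dif_neg h]
    split_ifs <;> rfl

theorem RCFMatrix.stabilize_mul {n : ℕ} (A B : Matrix (Fin n) (Fin n) ℤ) :
    stabilize (A * B) = stabilize A * stabilize B := by
  classical
  refine ext_entry fun i j => ?_
  by_cases hi : i < n
  · rw [mul_entry_of_row _ _ _ _ (Finset.range n), Finset.sum_range]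
    · by_cases hj : j < n
      · simp [stabilize_entry, hi, hj, Matrix.mul_apply]
      · have hne : ∀ x : Fin n, (x : ℕ) ≠ j := fun x => by omega
        simp [stabilize_entry, hi, hj, hne, show i ≠ j by omega]
    · intro k hk
      rw [stabilize_entry] at hk
      rw [Finset.mem_range]
      by_contra h
      rw [dif_neg (by omega), if_neg (by omega)] at hk
      exact hk rfl
  · rw [mul_entry_of_row _ _ _ _ {i}]
    · simp [stabilize_entry, hi]
    · intro k hk
      rw [stabilize_entry, dif_neg (by omega)] at hk
      rw [Finset.mem_singleton]
      by_contra h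
      exact hk (if_neg (Ne.symm h))

/-- The embedding `A ↦ A ⊕ 1` of special linear groups into the units of the infinite matrices. -/
noncomputable def stabilizeHom (n : ℕ) :
    Matrix.SpecialLinearGroup (Fin n) ℤ →* (RCFMatrix ℕ)ˣ :=
  (Units.map { toFun := stabilize, map_one' := stabilize_one n, map_mul' := stabilize_mul }).comp
    Matrix.SpecialLinearGroup.toGL

theorem stabilizeHom_val {n : ℕ} (A : Matrix.SpecialLinearGroup (Fin n) ℤ) :
    (stabilizeHom n A : RCFMatrix ℕ) = stabilize (A : Matrix (Fin n) (Fin n) ℤ) := rfl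

theorem stabilizeHom_transvection {n : ℕ} {i j : Fin n} (h : i ≠ j) :
    stabilizeHom n (Matrix.SpecialLinearGroup.transvection h 1)
      = elemUnit (single (i : ℕ) (j : ℕ)) := by
  classical
  ext1
  have h' : (i : ℕ) ≠ j := fun e => h (Fin.ext e)
  rw [stabilizeHom_val, elemUnit_val (single_mul_self h'),
    Matrix.SpecialLinearGroup.transvection_coe]
  refine ext_entry fun p q => ?_
  rw [stabilize_entry, add_entry, one_entry, single_entry]
  by_cases hpq : p < n ∧ q < n
  · rw [dif_pos hpq, Matrix.add_apply, Matrix.one_apply, Matrix.single_apply]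
    simp only [Fin.ext_iff]
    split_ifs <;> omega
  · rw [dif_neg hpq, if_neg (c := p = i ∧ q = j) (by omega), add_zero]
    split_ifs <;> rfl

theorem stabilizeHom_mem {n : ℕ} (A : Matrix.SpecialLinearGroup (Fin n) ℤ) :
    stabilizeHom n A ∈ elementarySubgroup := by
  have h : transvectionSubgroup (Fin n) ≤ elementarySubgroup.comap (stabilizeHom n) := by
    rw [transvectionSubgroup, Subgroup.closure_le]
    rintro _ ⟨i, j, hij, c, rfl⟩
    change stabilizeHom n _ ∈ elementarySubgroup
    have hone : stabilizeHom n (Matrix.SpecialLinearGroup.transvection hij 1)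
        ∈ elementarySubgroup := by
      rw [stabilizeHom_transvection hij]
      exact Subgroup.subset_closure ⟨i, j, fun e => hij (Fin.ext e), rfl⟩
    induction c using Int.induction_on with
    | zero =>
      rw [Matrix.SpecialLinearGroup.transvection_coeff_zero, map_one]
      exact one_mem _
    | succ k ih =>
      rw [Matrix.SpecialLinearGroup.transvection_add, map_mul]
      exact mul_mem ih hone
    | pred k ih =>
      rw [sub_eq_add_neg, Matrix.SpecialLinearGroup.transvection_add, map_mul,
        ← Matrix.SpecialLinearGroup.transvection_inv hij 1, map_inv]
      exact mul_mem ih (inv_mem hone)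
  rw [transvectionSubgroup_fin_eq_top] at h
  exact h trivial

/-- Choose n beyond all rows and columns where g − 1 is non-zero and such that the n-th block has
determinant 1. -/
theorem exists_stabilizeHom_eq {g : GLInf} (hg : g ∈ SLInf) :
    ∃ (n : ℕ) (A : Matrix.SpecialLinearGroup (Fin n) ℤ), stabilizeHom n A = g := by
  classical
  have hfin : (((g : (RCFMatrix ℕ)ˣ) : RCFMatrix ℕ) - 1) ∈ RCFMatrix.finMat ℕ := g.2
  rw [mem_finMat] at hfin
  obtain ⟨M, hM⟩ := (hfin.image Prod.fst).bddAbove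
  obtain ⟨N, hN⟩ := (hfin.image Prod.snd).bddAbove
  have hg' : ∀ᶠ n in Filter.atTop,
    (RCFMatrix.block n ((g : (RCFMatrix ℕ)ˣ) : RCFMatrix ℕ)).det = 1 := hg
  obtain ⟨n, hdet, hn⟩ := (hg'.and (Filter.eventually_gt_atTop (max M N))).exists
  refine ⟨n, ⟨_, hdet⟩, ?_⟩
  ext1
  refine (stabilizeHom_val _).trans (ext_entry fun i j => ?_)
  rw [stabilize_entry]
  by_cases h : i < n ∧ j < n
  · rw [dif_pos h]
    rfl
  · rw [dif_neg h]
    have h0 : (((g : (RCFMatrix ℕ)ˣ) : RCFMatrix ℕ) - 1).entry i j = 0 := by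
      by_contra hne
      have h1 := hM ⟨(i, j), hne, rfl⟩
      have h2 := hN ⟨(i, j), hne, rfl⟩
      dsimp only at h1 h2
      omega
    rw [sub_eq_add_neg, add_entry, neg_entry, one_entry, add_neg_eq_zero] at h0
    rw [h0]
    split_ifs <;> rfl

theorem exists_mem_SLInf {a b : ℕ} (hab : a ≠ b) :
    ∃ g ∈ SLInf, (g : (RCFMatrix ℕ)ˣ) = elemUnit (single a b) := by
  classical
  have hval := elemUnit_val (single_mul_self hab)
  refine ⟨⟨elemUnit (single a b), ?_⟩, ?_, rfl⟩
  · change (elemUnit (single a b) : RCFMatrix ℕ) - 1 ∈ finMat ℕ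
    rw [hval, add_sub_cancel_left]
    exact single_mem_finMat a b
  · change ∀ᶠ n in Filter.atTop, (block n (elemUnit (single a b) : RCFMatrix ℕ)).det = 1
    filter_upwards [Filter.eventually_gt_atTop (max a b)] with n hn
    have hne : (⟨a, by omega⟩ : Fin n) ≠ ⟨b, by omega⟩ := fun e => hab (congrArg Fin.val e)
    have e : block n (elemUnit (single a b) : RCFMatrix ℕ)
        = Matrix.transvection ⟨a, by omega⟩ ⟨b, by omega⟩ 1 := by
      ext i j
      change (elemUnit (single a b) : RCFMatrix ℕ).entry i j = _
      rw [hval, add_entry, one_entry, single_entry, Matrix.transvection, Matrix.add_apply,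
        Matrix.one_apply, Matrix.single_apply]
      simp only [Fin.ext_iff]
      split_ifs <;> omega
    rw [e, Matrix.det_transvection_of_ne _ _ hne]

/-- `SL_∞(ℤ)` is generated by the elementary matrices. -/
theorem range_SLInf : (GLInf.subtype.comp SLInf.subtype).range = elementarySubgroup := by
  refine le_antisymm ?_ ?_
  · rintro _ ⟨g, rfl⟩
    obtain ⟨n, A, e⟩ := exists_stabilizeHom_eq g.2
    change ((g : GLInf) : (RCFMatrix ℕ)ˣ) ∈ elementarySubgroup
    rw [← e]
    exact stabilizeHom_mem A
  · rw [elementarySubgroup, Subgroup.closure_le]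
    rintro _ ⟨a, b, hab, rfl⟩
    obtain ⟨g, hg, e⟩ := exists_mem_SLInf hab
    exact ⟨⟨g, hg⟩, e⟩

end InfiniteSpecialLinear

/-! ### Matrix units in the semidirect product ring. -/

namespace CrazyRing

open RCFMatrix

variable {G S : Type*} [Group G] [MulAction G S]

/-- The elementary matrix `E_{s,t}` as an element of the semidirect product. -/
noncomputable def matUnit (G : Type*) {S : Type*} [Group G] [MulAction G S] (s t : S) :
    CrazyRing G S :=
  ⟨0, single s t, single_mem_finMat s t⟩

/-- The homomorphism `(f, m) ↦ φ₀(f) + m` to the row and column finite matrices. -/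
noncomputable def toMat (G S : Type*) [Group G] [MulAction G S] : CrazyRing G S →+ RCFMatrix S where
  toFun r := phi₀ G S r.fst + r.snd
  map_zero' := by
    change phi₀ G S 0 + 0 = 0
    rw [map_zero, add_zero]
  map_add' r r' := by
    change phi₀ G S (r.fst + r'.fst) + (r.snd + r'.snd) = _
    rw [map_add]; abel

theorem toMat_apply (r : CrazyRing G S) : toMat G S r = phi₀ G S r.fst + r.snd := rfl

theorem toMat_mul (r r' : CrazyRing G S) : toMat G S (r * r') = toMat G S r * toMat G S r' := by
  change phi₀ G S (r.fst * r'.fst)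
    + (phi₀ G S r.fst * r'.snd + r.snd * phi₀ G S r'.fst + r.snd * r'.snd) = _
  rw [map_mul, toMat_apply, toMat_apply]
  noncomm_ring

theorem toMat_matUnit (s t : S) : toMat G S (matUnit G s t) = single s t := by
  change phi₀ G S 0 + single s t = single s t
  rw [map_zero, zero_add]

theorem matUnit_mul (s t t' u : S) :
    matUnit G s t * matUnit G t' u = ⟨0, single s t * single t' u,
      (finMat S).mul_mem_left _ _ (single_mem_finMat t' u)⟩ := by
  refine CrazyRing.ext (mul_zero _) ?_
  change phi₀ G S 0 * single t' u + single s t * phi₀ G S 0 + single s t * single t' u = _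
  simp

theorem matUnit_mul_matUnit (s t u : S) :
    matUnit G s t * matUnit G t u = matUnit G s u := by
  rw [matUnit_mul]
  exact CrazyRing.ext rfl (single_mul_single s t u)

theorem matUnit_mul_matUnit_of_ne (s u : S) {t t' : S} (h : t ≠ t') :
    matUnit G s t * matUnit G t' u = 0 := by
  rw [matUnit_mul]
  exact CrazyRing.ext rfl (single_mul_single_of_ne s u h)

theorem mem_matIdeal (r : CrazyRing G S) : r ∈ matIdeal G S ↔ r.fst = 0 := by
  simp [matIdeal]

theorem matUnit_mem_matIdeal (s t : S) : matUnit G s t ∈ matIdeal G S :=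
  (mem_matIdeal _).2 rfl

/-- The projection to the group ring, as an additive homomorphism. -/
noncomputable def fstHom (G S : Type*) [Group G] [MulAction G S] :
    CrazyRing G S →+ MonoidAlgebra ℤ G where
  toFun r := r.fst
  map_zero' := rfl
  map_add' _ _ := rfl

/-- An entry of the matrix component, as an additive homomorphism. -/
noncomputable def entryHom (G : Type*) {S : Type*} [Group G] [MulAction G S] (i j : S) :
    CrazyRing G S →+ ℤ where
  toFun r := r.snd.entry i j
  map_zero' := rfl
  map_add' _ _ := rfl

theorem exists_eq_sum_matUnit {r : CrazyRing G S} (hr : r ∈ matIdeal G S) :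
    ∃ (T : Finset (S × S)) (c : S × S → ℤ), r = ∑ p ∈ T, c p • matUnit G p.1 p.2 := by
  classical
  have hfin := (mem_finMat _).1 r.snd_mem
  refine ⟨hfin.toFinset, fun p => r.snd.entry p.1 p.2, ?_⟩
  set t := ∑ p ∈ hfin.toFinset, r.snd.entry p.1 p.2 • matUnit G p.1 p.2 with ht
  refine CrazyRing.ext ?_ (ext_entry fun i j => ?_)
  · have h : fstHom G S t = 0 := by
      rw [ht, map_sum]
      refine Finset.sum_eq_zero fun p _ => ?_
      rw [map_zsmul]
      exact smul_zero _
    exact ((mem_matIdeal r).1 hr).trans h.symm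
  · have h : entryHom G i j t = r.snd.entry i j := by
      have hterm (p : S × S) : entryHom G i j (r.snd.entry p.1 p.2 • matUnit G p.1 p.2)
          = if p = (i, j) then r.snd.entry i j else 0 := by
        rw [map_zsmul]
        change _ • (if i = p.1 ∧ j = p.2 then (1 : ℤ) else 0) = _
        by_cases hp : p = (i, j)
        · subst hp; simp
        · rw [if_neg hp, if_neg fun e => hp (Prod.ext e.1.symm e.2.symm), smul_zero]
      rw [ht, map_sum, Finset.sum_congr rfl fun p _ => hterm p, Finset.sum_ite_eq']
      split_ifs with hmem
      · rfl
      · by_contra hne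
        exact hmem (hfin.mem_toFinset.2 (Ne.symm hne))
    exact h.symm

end CrazyRing

/-! ### The groups Γ₀ and Δ₀. -/

section Gamma

open RCFMatrix CrazyRing Steinberg

variable {G S : Type*} [Group G] [MulAction G S] {s₀ : S}

/-- The representation of `St₄(R_{G,S})` by infinite matrices. -/
noncomputable def steinbergRep (G : Type*) {S : Type*} [Group G] [MulAction G S]
    (θ : ℕ ≃ S × Fin 4) : Steinberg (Fin 4) (CrazyRing G S) →* (RCFMatrix ℕ)ˣ :=
  Steinberg.rep (fun i j => (spread θ i j).comp (toMat G S))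
    (fun i j l r r' => by
      simp only [AddMonoidHom.comp_apply, toMat_mul, spread_mul_spread])
    (fun i j p q r r' h => spread_mul_spread_of_ne θ i q h _ _)

theorem steinbergRep_e (θ : ℕ ≃ S × Fin 4) {i j : Fin 4} (h : i ≠ j) (r : CrazyRing G S) :
    steinbergRep G θ (e i j h r) = elemUnit (spread θ i j (toMat G S r)) :=
  Steinberg.rep_e _ _ _ h r

theorem steinbergRep_rTilde (θ : ℕ ≃ S × Fin 4) (s : S) :
    steinbergRep G θ (rTilde (idem G s)) = 1 := by
  have hne : θ.symm (s, 0) ≠ θ.symm (s, 1) := θ.symm.injective.ne (by simp)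
  have hE : toMat G S (idem G s) = single s s := toMat_matUnit s s
  rw [rTilde, map_pow, map_mul, map_mul, steinbergRep_e, steinbergRep_e, map_neg, map_neg, hE,
    spread_single, spread_single]
  refine elemUnit_quarter_turn_pow_four (single_mul_self hne) (single_mul_self hne.symm) ?_ ?_ <;>
    simp only [single_mul_single]

/-- The representation of `Γ₀` by infinite matrices. -/
noncomputable def gammaRep (G : Type*) {S : Type*} [Group G] [MulAction G S] (s₀ : S)
    (θ : ℕ ≃ S × Fin 4) : Gamma₀ G s₀ →* (RCFMatrix ℕ)ˣ :=
  QuotientGroup.lift _ (steinbergRep G θ) (by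
    change Subgroup.normalClosure _ ≤ (steinbergRep G θ).ker
    rw [← Subgroup.normalClosure_subset_iff (N := (steinbergRep G θ).ker)]
    rintro _ rfl
    exact steinbergRep_rTilde θ s₀)

theorem gammaRep_mk (θ : ℕ ≃ S × Fin 4) (g : Steinberg (Fin 4) (CrazyRing G S)) :
    gammaRep G s₀ θ (QuotientGroup.mk g) = steinbergRep G θ g := rfl

/-- The images in `Γ₀` of the `e_{ij}(E_{s,t})`, indexed by `(s, i)` and `(t, j)`. -/
noncomputable def gammaBlock (G : Type*) {S : Type*} [Group G] [MulAction G S] (s₀ : S)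
    (θ : ℕ ≃ S × Fin 4) (a b : ℕ) : Gamma₀ G s₀ :=
  if h : (θ a).2 ≠ (θ b).2 then
    QuotientGroup.mk (e (θ a).2 (θ b).2 h (matUnit G (θ a).1 (θ b).1))
  else 1

theorem gammaBlock_of_ne (θ : ℕ ≃ S × Fin 4) {a b : ℕ} (h : (θ a).2 ≠ (θ b).2) :
    gammaBlock G s₀ θ a b
      = QuotientGroup.mk (e (θ a).2 (θ b).2 h (matUnit G (θ a).1 (θ b).1)) :=
  dif_pos h

theorem gammaBlock_symm (θ : ℕ ≃ S × Fin 4) (s t : S) {i j : Fin 4} (h : i ≠ j) :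
    gammaBlock G s₀ θ (θ.symm (s, i)) (θ.symm (t, j))
      = QuotientGroup.mk (e i j h (matUnit G s t)) := by
  simp [gammaBlock, h]

/-- The defining relations omit e_ij against e_ji. For a third l, write e_ij(E_{s,t}) =
[e_il(E_{s,s}), e_lj(E_{s,t})]; both entries commute with e_ji(E_{u,v}), since the relevant products
of matrix units vanish when s ≠ v and t ≠ u. -/
theorem Steinberg.e_matUnit_commute {i j p q : Fin 4} (hij : i ≠ j) (hpq : p ≠ q) {s t u v : S}
    (h1 : (t, j) ≠ (u, p)) (h2 : (s, i) ≠ (v, q)) :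
    Commute (e i j hij (matUnit G s t)) (e p q hpq (matUnit G u v)) := by
  have mul_zero {i j l : Fin 4} (hij : i ≠ j) (hjl : j ≠ l) (hil : i ≠ l) {s t u v : S}
      (h : t ≠ u) : Commute (e i j hij (matUnit G s t)) (e j l hjl (matUnit G u v)) := by
    rw [← commutatorElement_eq_one_iff_commute, commutatorElement_e hij hjl hil,
      matUnit_mul_matUnit_of_ne _ _ h, e_zero]
  by_cases hjp : j = p
  · subst hjp
    have htu : t ≠ u := fun h => h1 (by rw [h])
    by_cases hiq : i = q
    · subst hiq
      have hsv : s ≠ v := fun h => h2 (by rw [h])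
      obtain ⟨l, hli, hlj, _⟩ := Fin.exists_ne_three i j j
      rw [← matUnit_mul_matUnit s s t, ← commutatorElement_e hli.symm hlj hij,
        commutatorElement_def]
      have c1 : Commute (e i l hli.symm (matUnit G s s)) (e j i hpq (matUnit G u v)) :=
        (mul_zero hpq hli.symm hlj.symm hsv.symm).symm
      have c2 : Commute (e l j hlj (matUnit G s t)) (e j i hpq (matUnit G u v)) :=
        mul_zero hlj hpq hli htu
      exact ((c1.mul_left c2).mul_left c1.inv_left).mul_left c2.inv_left
    · exact mul_zero hij hpq hiq htu
  · by_cases hiq : i = q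
    · subst hiq
      exact (mul_zero hpq hij (Ne.symm hjp) fun h => h2 (by rw [h])).symm
    · exact e_commute hij hpq hjp hiq _ _

theorem blockSteinbergFamily_gammaBlock (θ : ℕ ≃ S × Fin 4) :
    BlockSteinbergFamily (fun a => (θ a).2) (gammaBlock G s₀ θ) where
  mul a b c hab hbc hac := by
    rw [gammaBlock_of_ne θ hab, gammaBlock_of_ne θ hbc, gammaBlock_of_ne θ hac,
      ← matUnit_mul_matUnit (θ a).1 (θ b).1 (θ c).1, ← commutatorElement_e hab hbc hac]
    rfl
  comm a b c d hab hcd hbc had := by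
    rw [gammaBlock_of_ne θ hab, gammaBlock_of_ne θ hcd]
    have := Steinberg.e_matUnit_commute (G := G) (s := (θ a).1) (t := (θ b).1) (u := (θ c).1)
      (v := (θ d).1) hab hcd (θ.injective.ne hbc) (θ.injective.ne had)
    exact this.map (QuotientGroup.mk' (Subgroup.normalClosure {rTilde (idem G s₀)}))

/-- The family of elementary elements of `Γ₀`, indexed by all pairs of distinct indices. -/
noncomputable def gammaFamily (G : Type*) {S : Type*} [Group G] [MulAction G S] (s₀ : S)
    (θ : ℕ ≃ S × Fin 4) : ℕ → ℕ → Gamma₀ G s₀ :=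
  blockExtension (fun a => (θ a).2) (fun i => θ.symm (s₀, i)) (gammaBlock G s₀ θ)

theorem gammaFamily_symm (θ : ℕ ≃ S × Fin 4) (s t : S) {i j : Fin 4} (h : i ≠ j) :
    gammaFamily G s₀ θ (θ.symm (s, i)) (θ.symm (t, j))
      = QuotientGroup.mk (e i j h (matUnit G s t)) := by
  rw [← gammaBlock_symm θ s t h, gammaFamily, blockExtension_of_ne (by simpa using h)]

theorem specialLinearFamily_gammaFamily (θ : ℕ ≃ S × Fin 4) :
    SpecialLinearFamily (gammaFamily G s₀ θ) := by
  have hx : SteinbergFamily (gammaFamily G s₀ θ) :=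
    (blockSteinbergFamily_gammaBlock θ).steinbergFamily (by simp)
  have hne : θ.symm (s₀, 0) ≠ θ.symm (s₀, 1) := θ.symm.injective.ne (by simp)
  refine hx.specialLinearFamily hne ?_
  have h1 : (QuotientGroup.mk (rTilde (idem G s₀)) : Gamma₀ G s₀) = 1 :=
    (QuotientGroup.eq_one_iff _).2 (Subgroup.subset_normalClosure rfl)
  have hneg : e (0 : Fin 4) 1 (by decide) (-idem G s₀)
      = (e (0 : Fin 4) 1 (by decide) (idem G s₀))⁻¹ := by
    rw [eq_inv_iff_mul_eq_one, e_mul_e, neg_add_cancel, e_zero]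
  have hE : matUnit G s₀ s₀ = idem G s₀ := rfl
  have hr : rTilde (idem G s₀) = ((e 0 1 (by decide) (idem G s₀))⁻¹ *
      e 1 0 (by decide) (idem G s₀) * (e 0 1 (by decide) (idem G s₀))⁻¹) ^ 4 := by
    rw [rTilde, hneg]
  have h2 := (congrArg (QuotientGroup.mk : _ → Gamma₀ G s₀) hr).symm.trans h1
  rw [weyl, gammaFamily_symm θ s₀ s₀ (by decide), gammaFamily_symm θ s₀ s₀ (by decide), hE]
  -- The base of the power r̃(E) is the inverse of the Weyl element, so r̃(E) = 1 is w⁻⁴ = 1.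
  rw [← inv_eq_one, ← inv_pow]
  refine Eq.trans ?_ h2
  simp only [mul_inv_rev, inv_inv, QuotientGroup.mk_pow, QuotientGroup.mk_mul,
    QuotientGroup.mk_inv, mul_assoc]

theorem gammaRep_gammaBlock (θ : ℕ ≃ S × Fin 4) {a b : ℕ} (h : (θ a).2 ≠ (θ b).2) :
    gammaRep G s₀ θ (gammaBlock G s₀ θ a b) = elemUnit (single a b) := by
  rw [gammaBlock_of_ne θ h, gammaRep_mk, steinbergRep_e, toMat_matUnit, spread_single]
  simp

theorem gammaRep_gammaFamily (θ : ℕ ≃ S × Fin 4) {a b : ℕ} (hab : a ≠ b) :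
    gammaRep G s₀ θ (gammaFamily G s₀ θ a b) = elemUnit (single a b) := by
  obtain ⟨m, hma, hmb, _⟩ := Fin.exists_ne_three (θ a).2 (θ b).2 (θ b).2
  set d := θ.symm (s₀, m) with hd
  have hm : (θ d).2 = m := by simp [hd]
  rw [← hm] at hma hmb
  have hda : a ≠ d := fun h => hma (by rw [h])
  have hdb : d ≠ b := fun h => hmb (by rw [h])
  rw [gammaFamily, ← (blockSteinbergFamily_gammaBlock θ).blockExtension_eq (by simp) hab hma hmb,
    map_commutatorElement, gammaRep_gammaBlock θ hma.symm, gammaRep_gammaBlock θ hmb]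
  exact commutatorElement_elemUnit (single_mul_self hda) (single_mul_self hdb)
    (single_mul_self hab) (single_mul_single _ _ _) (single_mul_single_of_ne _ _ hab.symm)

theorem isColumnMap_gammaRep (θ : ℕ ≃ S × Fin 4) :
    IsColumnMap (gammaFamily G s₀ θ)
      fun h b a => (gammaRep G s₀ θ h : RCFMatrix ℕ).entry a b where
  one b := by
    classical
    ext a
    rw [map_one, Units.val_one, one_entry, Pi.single_apply]
    split_ifs <;> rfl
  mul a b hab h c := by
    classical
    ext i
    rw [map_mul, gammaRep_gammaFamily θ hab, Units.val_mul, elemUnit_val (single_mul_self hab),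
      add_mul, one_mul, add_entry, single_mul_entry]
    by_cases hi : i = a
    · subst hi
      rw [if_pos rfl, shear_apply_self, one_mul]
    · rw [if_neg hi, shear_apply_of_ne _ _ _ hi, add_zero]

/-- Elements of the ideal are finite integer combinations of matrix units and e_ij is additive.
Conversely, every member of the family is a commutator of two elements e_ij(E_{s,t}). -/
theorem Delta₀_eq_closure (θ : ℕ ≃ S × Fin 4) :
    Delta₀ G s₀ = Subgroup.closure {g | ∃ a b, a ≠ b ∧ g = gammaFamily G s₀ θ a b} := by
  refine le_antisymm ?_ ?_
  · rw [Delta₀, Subgroup.closure_le]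
    rintro _ ⟨i, j, hij, r, hr, rfl⟩
    set K := Subgroup.closure {g | ∃ a b, a ≠ b ∧ g = gammaFamily G s₀ θ a b}
    let φ : Multiplicative (CrazyRing G S) →* Gamma₀ G s₀ :=
      (QuotientGroup.mk' (Subgroup.normalClosure {rTilde (idem G s₀)})).comp (eHom i j hij)
    have hgen (s t : S) : Multiplicative.ofAdd (matUnit G s t) ∈ K.comap φ := by
      change QuotientGroup.mk (e i j hij (matUnit G s t)) ∈ K
      rw [← gammaFamily_symm θ s t hij]
      exact Subgroup.subset_closure ⟨_, _, θ.symm.injective.ne (by simp [hij]), rfl⟩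
    obtain ⟨T, c, e⟩ := exists_eq_sum_matUnit hr
    change Multiplicative.ofAdd r ∈ K.comap φ
    rw [e, ofAdd_sum]
    refine Subgroup.prod_mem _ fun p _ => ?_
    rw [ofAdd_zsmul]
    exact zpow_mem (hgen p.1 p.2) _
  · rw [Subgroup.closure_le]
    rintro _ ⟨a, b, hab, rfl⟩
    have hblock {p q : ℕ} (h : (θ p).2 ≠ (θ q).2) : gammaBlock G s₀ θ p q ∈ Delta₀ G s₀ := by
      rw [gammaBlock_of_ne θ h]
      exact Subgroup.subset_closure ⟨_, _, h, _, matUnit_mem_matIdeal _ _, rfl⟩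
    obtain ⟨m, hma, hmb, _⟩ := Fin.exists_ne_three (θ a).2 (θ b).2 (θ b).2
    have hm : (θ (θ.symm (s₀, m))).2 = m := by simp
    rw [← hm] at hma hmb
    rw [gammaFamily,
      ← (blockSteinbergFamily_gammaBlock θ).blockExtension_eq (by simp) hab hma hmb,
      commutatorElement_def]
    have h1 := hblock hma.symm
    have h2 := hblock hmb
    exact mul_mem (mul_mem (mul_mem h1 h2) (inv_mem h1)) (inv_mem h2)

theorem range_Delta₀ (θ : ℕ ≃ S × Fin 4) :
    ((gammaRep G s₀ θ).comp (Delta₀ G s₀).subtype).range = elementarySubgroup := by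
  rw [MonoidHom.range_comp, Subgroup.range_subtype, Delta₀_eq_closure θ, MonoidHom.map_closure,
    elementarySubgroup]
  congr 1
  ext g
  constructor
  · rintro ⟨_, ⟨a, b, hab, rfl⟩, rfl⟩
    exact ⟨a, b, hab, gammaRep_gammaFamily θ hab⟩
  · rintro ⟨a, b, hab, rfl⟩
    exact ⟨_, ⟨a, b, hab, rfl⟩, gammaRep_gammaFamily θ hab⟩

theorem gammaRep_injective_Delta₀ (θ : ℕ ≃ S × Fin 4) :
    Function.Injective ((gammaRep G s₀ θ).comp (Delta₀ G s₀).subtype) := by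
  rw [injective_iff_map_eq_one]
  intro h hh
  have hmem : (h : Gamma₀ G s₀)
      ∈ Subgroup.closure {g | ∃ a b, a ≠ b ∧ g = gammaFamily G s₀ θ a b} := by
    rw [← Delta₀_eq_closure θ]
    exact h.2
  have hcol := isColumnMap_gammaRep (G := G) (s₀ := s₀) θ
  refine Subtype.ext ((specialLinearFamily_gammaFamily θ).eq_one_of_columns_eq hcol hmem fun b => ?_)
  have hh' : gammaRep G s₀ θ h = 1 := hh
  have := hcol.one b
  simp only [map_one] at this
  simp only [hh', this]

end Gamma

theorem lemma3p4 {G S : Type*} [Group G] [MulAction G S] [Countable S] [Infinite S] (s₀ : S) :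
    Nonempty (Delta₀ G s₀ ≃* SLInf) := by
  obtain ⟨θ⟩ : Nonempty (ℕ ≃ S × Fin 4) := nonempty_equiv_of_countable
  have hinj : Function.Injective (GLInf.subtype.comp SLInf.subtype) :=
    GLInf.subtype_injective.comp SLInf.subtype_injective
  exact ⟨(MonoidHom.ofInjective (gammaRep_injective_Delta₀ θ)).trans
    ((MulEquiv.subgroupCongr ((range_Delta₀ θ).trans range_SLInf.symm)).trans
      (MonoidHom.ofInjective hinj).symm)⟩
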